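/- For bounded real sequences $a,b$ on $\mathbb Z$ with $\inf_n a_n>0$, let $\mathscr J=\mathscr J_{a,b}$ be the Jacobi matrix on $\ell^2(\mathbb Z)$, $(\mathscr J\varphi)_n=a_{n-1}\varphi_{n-1}+b_n\varphi_n+a_n\varphi_{n+1}$. For $R>0$ let $\mathcal J(R)$ be the set of all such $\mathscr J$ with $\|\mathscr J\|\le R$ and $\inf_n a_n\ge R^{-1}$. Call $\mathscr J$ $q$-periodic, for an integer $q\ge 1$, if $a_{n+q}=a_n$ and $b_{n+q}=b_n$ for all $n\in\mathbb Z$. For a $q$-periodic $\mathscr J$ and $\theta\in\mathbb R/2\pi\mathbb Z$ let $\mathscr J_\theta$ and $A_\theta$ be the Hermitian $q\times q$ matrices $$\mathscr J_\theta=\sum_{j=1}^q b_jE_{j,j}+\sum_{j=1}^{q-1}a_j\,(E_{j,j+1}+E_{j+1,j})+a_q\,(e^{-i\theta}E_{1,q}+e^{i\theta}E_{q,1}),$$ $$A_\theta=\sum_{j=1}^{q-1}i a_j\,(E_{j,j+1}-E_{j+1,j})-i a_q\,(e^{-i\theta}E_{1,q}-e^{i\theta}E_{q,1}),$$ where $E_{j,k}$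 are the matrix units (terms falling on the same entry are added when $q\le 2$). They are the Floquet fibers of $\mathscr J$ and of $A=i[\mathscr J,X]$, where $(X\varphi)_n=n\varphi_n$ is the position operator. Let $\lambda_1(\theta)\le\dots\le\lambda_q(\theta)$ be the eigenvalues of $\mathscr J_\theta$ counted with multiplicity, which are differentiable functions of $\theta\notin\{0,\pi\}$, let $P_j(\theta)$ be the orthogonal projection of $\mathbb C^q$ onto $\ker(\mathscr J_\theta-\lambda_j(\theta))$, and for $\theta\notin\{0,\pi\}$ let $$Q_\theta=q\sum_{j=1}^q\lambda_j'(\theta)\,P_j(\theta),$$ the fiber of the asymptotic velocity operator. Theorem. For every $R>0$ there exists a constant $C_1=C_1(R)>1$ such that for every $q\ge1$, every $q$-periodic Jacobi matrix $\mathscr J\in\mathcal J(R)$ and every $t>0$, $$\left(\int_0^{2\pi}\left\|Q_\theta-\frac1t\int_0^t e^{is\mathscr J_\theta}A_\theta e^{-is\mathscr J_\theta}\,ds\right\|^2\frac{d\theta}{2\pi}\right)^{1/2}\le C_1^{\,q}\,t^{-1/5},$$ where $\|\cdot\|$ is the operator norm on $\mathbb C^q$ with the Euclidean norm. -/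

import Mathlib

open MeasureTheory Set

noncomputable section

/-- The Hilbert space `ℓ²(ℤ)` of square summable complex sequences. -/
abbrev EllTwo : Type := lp (fun _ : ℤ => ℂ) 2

theorem sum_weightedShift_le {c : ℤ → ℝ} {C : ℝ} (hc : ∀ n, |c n| ≤ C) (k : ℤ) (φ : EllTwo)
    (s : Finset ℤ) :
    ∑ n ∈ s, ‖(c n : ℂ) * φ (n + k)‖ ^ (2 : ENNReal).toReal
      ≤ (C * ‖φ‖) ^ (2 : ENNReal).toReal := by
  have hC : 0 ≤ C := (abs_nonneg _).trans (hc 0)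
  have h2 : 0 < (2 : ENNReal).toReal := by norm_num
  rw [Real.mul_rpow hC (norm_nonneg _)]
  calc ∑ n ∈ s, ‖(c n : ℂ) * φ (n + k)‖ ^ (2 : ENNReal).toReal
      ≤ ∑ n ∈ s, C ^ (2 : ENNReal).toReal * ‖φ (n + k)‖ ^ (2 : ENNReal).toReal := by
        refine Finset.sum_le_sum fun n _ => ?_
        rw [norm_mul, Real.mul_rpow (norm_nonneg _) (norm_nonneg _), Complex.norm_real,
          Real.norm_eq_abs]
        exact mul_le_mul_of_nonneg_right (Real.rpow_le_rpow (abs_nonneg _) (hc n) h2.le)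
          (by positivity)
    _ = C ^ (2 : ENNReal).toReal *
          ∑ m ∈ s.map (addRightEmbedding k), ‖φ m‖ ^ (2 : ENNReal).toReal := by
        rw [Finset.sum_map, Finset.mul_sum]; rfl
    _ ≤ _ := mul_le_mul_of_nonneg_left (lp.sum_rpow_le_norm_rpow h2 φ _) (by positivity)

/-- The bounded operator `φ ↦ (n ↦ c n * φ (n + k))` on `ℓ²(ℤ)`, for a bounded real sequence
`c`. -/
def weightedShift (k : ℤ) (c : ℤ → ℝ) (hc : ∃ C : ℝ, ∀ n, |c n| ≤ C) : EllTwo →L[ℂ] EllTwo :=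
  LinearMap.mkContinuousOfExistsBound
    { toFun := fun φ => ⟨fun n => (c n : ℂ) * φ (n + k),
        memℓp_gen' (fun s => sum_weightedShift_le hc.choose_spec k φ s)⟩
      map_add' := fun φ ψ => by
        ext n; exact mul_add (c n : ℂ) (φ (n + k)) (ψ (n + k))
      map_smul' := fun z φ => by
        ext n; exact mul_left_comm (c n : ℂ) z (φ (n + k)) }
    (by
      obtain ⟨C, hC⟩ := hc
      refine ⟨C, fun φ => ?_⟩
      have hC0 : 0 ≤ C := (abs_nonneg _).trans (hC 0)
      exact lp.norm_le_of_forall_sum_le (by norm_num) (by positivity)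
        (fun s => sum_weightedShift_le hC k φ s))

/-- The coefficients of a Jacobi matrix on `ℓ²(ℤ)`: bounded real sequences `a`, `b` with
`inf a > 0`. -/
structure JacobiMatrix where
  /-- the off-diagonal coefficients -/
  a : ℤ → ℝ
  /-- the diagonal coefficients -/
  b : ℤ → ℝ
  a_bdd : ∃ C : ℝ, ∀ n, |a n| ≤ C
  b_bdd : ∃ C : ℝ, ∀ n, |b n| ≤ C
  a_pos : ∃ c : ℝ, 0 < c ∧ ∀ n, c ≤ a n

namespace JacobiMatrix

/-- The bounded operator `(J φ)ₙ = aₙ₋₁ φₙ₋₁ + bₙ φₙ + aₙ φₙ₊₁` on `ℓ²(ℤ)`. -/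
def op (J : JacobiMatrix) : EllTwo →L[ℂ] EllTwo :=
  weightedShift (-1) (fun n => J.a (n - 1)) (J.a_bdd.imp fun _ h n => h (n - 1))
    + weightedShift 0 J.b J.b_bdd + weightedShift 1 J.a J.a_bdd

theorem op_apply (J : JacobiMatrix) (φ : EllTwo) (n : ℤ) :
    J.op φ n = (J.a (n - 1) : ℂ) * φ (n - 1) + (J.b n : ℂ) * φ n + (J.a n : ℂ) * φ (n + 1) := by
  have h : J.op φ n = (J.a (n - 1) : ℂ) * φ (n + -1) + (J.b n : ℂ) * φ (n + 0)
    + (J.a n : ℂ) * φ (n + 1) := rfl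
  rw [h, add_zero, ← sub_eq_add_neg]

/-- The class of Jacobi matrices with operator norm at most `R` and off-diagonal coefficients at
least `R⁻¹`. -/
def boundedClass (R : ℝ) : Set JacobiMatrix :=
  {J | ‖J.op‖ ≤ R ∧ ∀ n, R⁻¹ ≤ J.a n}

/-- `q`-periodicity; `q` need not be the least period. -/
def IsPeriodic (J : JacobiMatrix) (q : ℕ) : Prop :=
  0 < q ∧ (∀ n, J.a (n + q) = J.a n) ∧ ∀ n, J.b (n + q) = J.b n

/-- The Floquet matrix `J_θ`. The row and column `j : Fin q` belong to the site `j + 1`, so the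
sites are `1, …, q`. Contributions to the same entry are added, which matters for `q ≤ 2` only. -/
def floquet (J : JacobiMatrix) (q : ℕ) (θ : ℝ) : Matrix (Fin q) (Fin q) ℂ :=
  Matrix.of fun j k =>
    (if j = k then (J.b ((j : ℤ) + 1) : ℂ) else 0)
    + (if (k : ℕ) = j + 1 then (J.a ((j : ℤ) + 1) : ℂ) else 0)
    + (if (j : ℕ) = k + 1 then (J.a ((k : ℤ) + 1) : ℂ) else 0)
    + (if (j : ℕ) = 0 ∧ (k : ℕ) + 1 = q then
        Complex.exp (-(Complex.I * θ)) * (J.a q : ℂ) else 0)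
    + (if (j : ℕ) + 1 = q ∧ (k : ℕ) = 0 then
        Complex.exp (Complex.I * θ) * (J.a q : ℂ) else 0)

/-- The fibre `A_θ` of the velocity operator `A = i[J, X]`, where `X` is the position operator:
`(A φ)ₙ = i (aₙ φₙ₊₁ - aₙ₋₁ φₙ₋₁)`. -/
def velocity (J : JacobiMatrix) (q : ℕ) (θ : ℝ) : Matrix (Fin q) (Fin q) ℂ :=
  Matrix.of fun j k =>
    (if (k : ℕ) = j + 1 then Complex.I * (J.a ((j : ℤ) + 1) : ℂ) else 0)
    + (if (j : ℕ) = k + 1 then -(Complex.I * (J.a ((k : ℤ) + 1) : ℂ)) else 0)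
    + (if (j : ℕ) = 0 ∧ (k : ℕ) + 1 = q then
        -(Complex.I * Complex.exp (-(Complex.I * θ)) * (J.a q : ℂ)) else 0)
    + (if (j : ℕ) + 1 = q ∧ (k : ℕ) = 0 then
        Complex.I * Complex.exp (Complex.I * θ) * (J.a q : ℂ) else 0)

theorem floquet_isHermitian (J : JacobiMatrix) (q : ℕ) (θ : ℝ) :
    (J.floquet q θ).IsHermitian := by
  ext j k
  have e1 : (starRingEnd ℂ) (Complex.exp (-(Complex.I * θ))) = Complex.exp (Complex.I * θ) := by
    rw [← Complex.exp_conj]; simp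
  have e2 : (starRingEnd ℂ) (Complex.exp (Complex.I * θ)) = Complex.exp (-(Complex.I * θ)) := by
    rw [← Complex.exp_conj]; simp
  simp only [Matrix.conjTranspose_apply, floquet, Matrix.of_apply, RCLike.star_def, map_add,
    apply_ite (starRingEnd ℂ), map_zero, Complex.conj_ofReal, map_mul, e1, e2]
  have h1 : (if k = j then (J.b ((k : ℤ) + 1) : ℂ) else 0)
      = if j = k then (J.b ((j : ℤ) + 1) : ℂ) else 0 := by
    by_cases h : j = k
    · subst h; rfl
    · rw [if_neg h, if_neg (Ne.symm h)]
  rw [h1]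
  simp only [and_comm]
  ring

/-- The Floquet eigenvalues of `J_θ`, repeated by multiplicity, in increasing order. -/
def eigenvalue (J : JacobiMatrix) (q : ℕ) (j : Fin q) (θ : ℝ) : ℝ :=
  (J.floquet_isHermitian q θ).eigenvalues₀ (Fin.cast (Fintype.card_fin q).symm j.rev)

/-- The orthogonal projection `P_j(θ)` of `ℂ^q` onto `ker (J_θ - λ_j(θ))`. -/
def eigenprojection (J : JacobiMatrix) (q : ℕ) (j : Fin q) (θ : ℝ) :
    EuclideanSpace ℂ (Fin q) →L[ℂ] EuclideanSpace ℂ (Fin q) :=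
  (Module.End.eigenspace (Matrix.toEuclideanLin (J.floquet q θ))
    (J.eigenvalue q j θ : ℂ)).starProjection

/-- The fibre `Q_θ = q ∑ⱼ λ_j'(θ) P_j(θ)` of the asymptotic velocity operator. -/
def asymptoticVelocity (J : JacobiMatrix) (q : ℕ) (θ : ℝ) :
    EuclideanSpace ℂ (Fin q) →L[ℂ] EuclideanSpace ℂ (Fin q) :=
  (q : ℂ) • ∑ j : Fin q, ((deriv (J.eigenvalue q j) θ : ℝ) : ℂ) • J.eigenprojection q j θ

/-- The Heisenberg evolution `e^{i s J_θ} A_θ e^{-i s J_θ}` of the fibre `A_θ`. -/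
def heisenberg (J : JacobiMatrix) (q : ℕ) (θ s : ℝ) :
    EuclideanSpace ℂ (Fin q) →L[ℂ] EuclideanSpace ℂ (Fin q) :=
  NormedSpace.exp ((Complex.I * (s : ℂ)) • Matrix.toEuclideanCLM (𝕜 := ℂ) (J.floquet q θ))
    * Matrix.toEuclideanCLM (𝕜 := ℂ) (J.velocity q θ)
    * NormedSpace.exp
        (-((Complex.I * (s : ℂ)) • Matrix.toEuclideanCLM (𝕜 := ℂ) (J.floquet q θ)))

/-- The time average `t⁻¹ ∫₀ᵗ e^{i s J_θ} A_θ e^{-i s J_θ} ds`. -/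
def averagedVelocity (J : JacobiMatrix) (q : ℕ) (θ t : ℝ) :
    EuclideanSpace ℂ (Fin q) →L[ℂ] EuclideanSpace ℂ (Fin q) :=
  ((t⁻¹ : ℝ) : ℂ) • ∫ s in (0 : ℝ)..t, J.heisenberg q θ s

end JacobiMatrix

end

/-! In an orthonormal eigenbasis of `J_θ`, the time average multiplies the `(j, k)` entry of `A_θ`
by the average of `exp (i s (λ_j - λ_k))`. Diagonal entries are unchanged, and by Feynman–Hellmann
they are `q λ_j'`: `A_θ` is `q ∂_θ J_θ` plus a commutator with `J_θ`, which has zero expectation in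
eigenvectors. So `Q_θ` is the diagonal part of `A_θ`, and the error consists of off-diagonal
entries, damped by `min (1, 2 / (t |λ_j - λ_k|))`.

Everything rests on a lower bound for the gaps (`sin_sq_le_mul_gap`). The characteristic polynomial
of `J_θ` is `D - 2p cos θ`, where `D` does not depend on `θ` and `p` is the product of the `a_j`
over a period. At `θ = 0, π` this shows that `D ∓ 2p` are real-rooted, so Laguerre's inequality
forces `|D| ≥ 2p` at every critical point of `D`. Between two eigenvalues there is a critical point,
where `|D - 2p cos θ| ≥ 2p (1 - |cos θ|) ≥ p sin² θ`; but this value is at most the gap times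
`(10R)^q`. With `p ≥ R^{-q}`, every gap is at least `sin² θ / (10R²)^q`.

Interpolating the damping to the power `1/5` bounds the squared error by `t^{-2/5} |sin θ|^{-4/5}`
up to an exponential in `q`, and this is integrable over `θ`. -/

noncomputable section

/-! ### Real-rooted polynomials and Laguerre's inequality. -/

section RealRooted
open Polynomial

/-- Induction on the factors: for `f = (x - a) p` one has `f'² - f f'' = (x - a)² (p'² - p p'') +
p²`. The extra `p²` also gives the strict version. -/
theorem Polynomial.sq_derivative_sub_nonneg {ι : Type*} (s : Finset ι) (r : ι → ℝ) (x : ℝ) :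
    0 ≤ ((derivative (∏ i ∈ s, (X - C (r i)))).eval x) ^ 2
      - (∏ i ∈ s, (X - C (r i))).eval x
        * (derivative (derivative (∏ i ∈ s, (X - C (r i))))).eval x := by
  classical
  induction s using Finset.induction_on with
  | empty => simp
  | insert a s ha ih =>
    rw [Finset.prod_insert ha]
    set p := ∏ i ∈ s, (X - C (r i))
    simp only [derivative_mul, derivative_sub, derivative_X, derivative_C, derivative_add,
      sub_zero, one_mul, eval_add, eval_mul, eval_sub, eval_X, eval_C]
    nlinarith [mul_nonneg (sq_nonneg (x - r a)) ih, sq_nonneg (p.eval x)]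

/-- Laguerre's inequality for real-rooted polynomials. -/
theorem Polynomial.sq_derivative_sub_pos {ι : Type*} {s : Finset ι} (hs : s.Nonempty)
    (r : ι → ℝ) {x : ℝ} (hx : (∏ i ∈ s, (X - C (r i))).eval x ≠ 0) :
    0 < ((derivative (∏ i ∈ s, (X - C (r i)))).eval x) ^ 2
      - (∏ i ∈ s, (X - C (r i))).eval x
        * (derivative (derivative (∏ i ∈ s, (X - C (r i))))).eval x := by
  classical
  obtain ⟨a, ha⟩ := hs
  have ih := sq_derivative_sub_nonneg (s.erase a) r x
  rw [← Finset.mul_prod_erase s _ ha] at hx ⊢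
  set p := ∏ i ∈ s.erase a, (X - C (r i))
  have hp : p.eval x ≠ 0 := fun h => hx (by rw [eval_mul, h, mul_zero])
  have := sq_pos_of_ne_zero hp
  simp only [derivative_mul, derivative_sub, derivative_X, derivative_C, derivative_add,
    sub_zero, one_mul, eval_add, eval_mul, eval_sub, eval_X, eval_C]
  nlinarith [mul_nonneg (sq_nonneg (x - r a)) ih]

/-- If `D - c` and `D + c` are real-rooted, then every critical value of `D` is at least `c` in
absolute value. -/
theorem Polynomial.le_abs_eval_of_derivative_eq_zero {q : ℕ} (hq : 0 < q) {D : ℝ[X]} {c : ℝ}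
    {r s : Fin q → ℝ} (hr : D - C c = ∏ i, (X - C (r i))) (hs : D + C c = ∏ i, (X - C (s i)))
    {x : ℝ} (hx : (derivative D).eval x = 0) : c ≤ |D.eval x| := by
  by_contra! h
  obtain ⟨h1, h2⟩ := abs_lt.1 h
  have hne : (Finset.univ : Finset (Fin q)).Nonempty := ⟨⟨0, hq⟩, Finset.mem_univ _⟩
  -- At a critical point with `|D| < c`, Laguerre for `D - c < 0` forces `D'' > 0`, while Laguerre
  -- for `D + c > 0` forces `D'' < 0`.
  have k1 := sq_derivative_sub_pos hne r (x := x) (by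
    rw [← hr, eval_sub, eval_C]; exact (by linarith : D.eval x - c < 0).ne)
  have k2 := sq_derivative_sub_pos hne s (x := x) (by
    rw [← hs, eval_add, eval_C]; exact (by linarith : 0 < D.eval x + c).ne')
  rw [← hr] at k1
  rw [← hs] at k2
  simp only [derivative_sub, derivative_add, derivative_C, sub_zero, add_zero, eval_sub, eval_add,
    eval_C, hx] at k1 k2
  have k3 : 0 < (derivative (derivative D)).eval x := by
    by_contra! h'
    nlinarith [mul_nonneg_of_nonpos_of_nonpos (by linarith : D.eval x - c ≤ 0) h']
  nlinarith [mul_pos k3 (by linarith : 0 < D.eval x + c)]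

end RealRooted

/-! ### Determinants of tridiagonal matrices with corner entries. -/

namespace Matrix

/-- This is a cofactor: without row `0` and the last column, the remaining minor is upper triangular
and its diagonal is the subdiagonal of `M`. -/
theorem det_updateRow_zero_last {n : ℕ} (M : Matrix (Fin (n + 2)) (Fin (n + 2)) ℂ)
    (h : ∀ i j : Fin (n + 2), (j : ℕ) + 2 ≤ i → M i j = 0) :
    (M.updateRow 0 (Pi.single (Fin.last _) 1)).det
      = (-1) ^ (n + 1) * ∏ i : Fin (n + 1), M i.succ i.castSucc := by
  rw [← adjugate_apply, adjugate_fin_succ_eq_det_submatrix, Fin.succAbove_zero,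
    Fin.succAbove_last, det_of_isUpperTriangular]
  · simp
  · intro i j hij
    exact h _ _ (by
      simp only [id, Fin.lt_def] at hij
      simp only [Fin.val_succ, Fin.val_castSucc]
      omega)

theorem det_updateRow_last_zero {n : ℕ} (M : Matrix (Fin (n + 2)) (Fin (n + 2)) ℂ)
    (h : ∀ i j : Fin (n + 2), (i : ℕ) + 2 ≤ j → M i j = 0) :
    (M.updateRow (Fin.last _) (Pi.single 0 1)).det
      = (-1) ^ (n + 1) * ∏ i : Fin (n + 1), M i.castSucc i.succ := by
  rw [← adjugate_apply, adjugate_fin_succ_eq_det_submatrix, Fin.succAbove_zero,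
    Fin.succAbove_last, det_of_isLowerTriangular]
  · simp
  · intro i j hij
    exact h _ _ (by
      simp only [OrderDual.toDual_lt_toDual, Fin.lt_def] at hij
      simp only [Fin.val_succ, Fin.val_castSucc]
      omega)

/-- The determinant of a tridiagonal matrix with two extra corner entries. -/
theorem det_tridiagonal_add_corners {n : ℕ} (M : Matrix (Fin (n + 2)) (Fin (n + 2)) ℂ)
    (hl : ∀ i j : Fin (n + 2), (j : ℕ) + 2 ≤ i → M i j = 0)
    (hu : ∀ i j : Fin (n + 2), (i : ℕ) + 2 ≤ j → M i j = 0)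
    (x y : ℂ) :
    (M + single 0 (Fin.last _) x + single (Fin.last _) 0 y).det
      = M.det + x * ((-1) ^ (n + 1) * ∏ i : Fin (n + 1), M i.succ i.castSucc)
        + y * ((-1) ^ (n + 1) * ∏ i : Fin (n + 1), M i.castSucc i.succ)
        + x * y * ((M.updateRow 0 (Pi.single (Fin.last _) 1)).updateRow (Fin.last _)
            (Pi.single 0 1)).det := by
  have h0 : (Fin.last (n + 1)) ≠ 0 := (Fin.last_pos).ne'
  -- The corners alter only rows `0` and last, which are distinct, so multilinearity in these two
  -- rows yields four terms.
  have e : M + single 0 (Fin.last _) x + single (Fin.last _) 0 y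
      = (M.updateRow 0 (M 0 + x • Pi.single (Fin.last _) 1)).updateRow (Fin.last _)
        (M (Fin.last _) + y • Pi.single 0 1) := by
    ext i j
    by_cases hi : i = Fin.last _
    · subst hi
      rw [updateRow_self]
      by_cases hj : j = 0
      · subst hj; simp [h0.symm]
      · simp [h0.symm, hj, Ne.symm hj]
    · rw [updateRow_ne hi]
      by_cases hi0 : i = 0
      · subst hi0
        by_cases hj : j = Fin.last _
        · subst hj; simp [h0]
        · simp [h0, hj, Ne.symm hj]
      · simp [hi0, Ne.symm hi, Ne.symm hi0]
  have s1 : ∀ v : Fin (n + 2) → ℂ, (M.updateRow 0 v).updateRow (Fin.last _) (M (Fin.last _))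
      = M.updateRow 0 v := by
    intro v
    have : M (Fin.last _) = (M.updateRow 0 v) (Fin.last _) := by
      ext j; rw [updateRow_ne h0]
    rw [this, updateRow_eq_self]
  have s2 : ∀ v w : Fin (n + 2) → ℂ, (M.updateRow 0 v).updateRow (Fin.last _) w
      = (M.updateRow (Fin.last _) w).updateRow 0 v := fun v w => by
    ext i j
    simp only [updateRow_apply]
    split_ifs with h1 h2 <;> first | rfl | (exact absurd (h1.symm.trans h2) h0)
  have s3 : ∀ w : Fin (n + 2) → ℂ, (M.updateRow (Fin.last _) w).updateRow 0 (M 0)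
      = M.updateRow (Fin.last _) w := by
    intro w
    have : M 0 = (M.updateRow (Fin.last _) w) 0 := by
      ext j; rw [updateRow_ne h0.symm]
    rw [this, updateRow_eq_self]
  rw [e, det_updateRow_add, s1, det_updateRow_add, updateRow_eq_self, det_updateRow_smul,
    det_updateRow_zero_last M hl, det_updateRow_smul, s2, det_updateRow_add, s3,
    det_updateRow_last_zero M hu, det_updateRow_smul, ← s2]
  ring

end Matrix

/-- For Gershgorin row sums: each type of entry occurs at most once in a row. -/
theorem Finset.sum_ite_le_of_unique {ι : Type*} (s : Finset ι) (p : ι → Prop) [DecidablePred p]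
    (hp : ∀ i j, p i → p j → i = j) {c : ℝ} (hc : 0 ≤ c) :
    ∑ i ∈ s, (if p i then c else 0) ≤ c := by
  rw [← Finset.sum_filter, Finset.sum_const, nsmul_eq_mul]
  have h : (s.filter p).card ≤ 1 := Finset.card_le_one.2 fun i hi j hj =>
    hp i j (Finset.mem_filter.1 hi).2 (Finset.mem_filter.1 hj).2
  exact mul_le_of_le_one_left hc (by exact_mod_cast h)

/-! ### Characteristic polynomial of the Floquet matrices and the discriminant. -/

namespace JacobiMatrix
open Polynomial

variable (J : JacobiMatrix)

/-- The product of the off-diagonal coefficients over the sites `1, …, q`. -/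
def hopProd (q : ℕ) : ℝ := ∏ j : Fin q, J.a ((j : ℤ) + 1)

/-- Each corner alone contributes its phase `e^{∓iθ}` times the product of all hoppings; both
corners together contribute a term in which the phases cancel. -/
theorem exists_det_floquet {q : ℕ} (hq : 0 < q) : ∃ D : ℂ → ℂ, ∀ (z : ℂ) (θ : ℝ),
    (Matrix.scalar (Fin q) z - J.floquet q θ).det
      = D z - 2 * (J.hopProd q : ℂ) * (Real.cos θ : ℂ) := by
  have hc : ∀ θ : ℝ, 2 * (Real.cos θ : ℂ)
      = Complex.exp (Complex.I * θ) + Complex.exp (-(Complex.I * θ)) := fun θ => by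
    rw [Complex.ofReal_cos, Complex.cos]; ring_nf
  obtain _ | _ | n := q
  · omega
  · refine ⟨fun z => z - J.b 1, fun z θ => ?_⟩
    have := hc θ
    simp [floquet, hopProd, Matrix.det_unique] at this ⊢
    linear_combination (J.a 1 : ℂ) * this
  · let M : ℂ → Matrix (Fin (n + 2)) (Fin (n + 2)) ℂ := fun z =>
      Matrix.scalar (Fin (n + 2)) z - Matrix.of fun (j k : Fin (n + 2)) =>
        (if j = k then (J.b ((j : ℤ) + 1) : ℂ) else 0)
        + (if (k : ℕ) = j + 1 then (J.a ((j : ℤ) + 1) : ℂ) else 0)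
        + (if (j : ℕ) = k + 1 then (J.a ((k : ℤ) + 1) : ℂ) else 0)
    have hM : ∀ z θ, Matrix.scalar (Fin (n + 2)) z - J.floquet (n + 2) θ
        = M z + Matrix.single 0 (Fin.last _)
            (-(Complex.exp (-(Complex.I * θ)) * (J.a (n + 2 : ℕ) : ℂ)))
          + Matrix.single (Fin.last _) 0
            (-(Complex.exp (Complex.I * θ) * (J.a (n + 2 : ℕ) : ℂ))) := fun z θ => by
      ext j k
      have e1 : ((j : ℕ) = 0 ∧ (k : ℕ) + 1 = n + 2) ↔ (0 = j ∧ Fin.last (n + 1) = k) := by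
        simp only [Fin.ext_iff, Fin.val_zero, Fin.val_last]; omega
      have e2 : ((j : ℕ) + 1 = n + 2 ∧ (k : ℕ) = 0) ↔ (Fin.last (n + 1) = j ∧ 0 = k) := by
        simp only [Fin.ext_iff, Fin.val_zero, Fin.val_last]; omega
      simp only [M, floquet, Matrix.add_apply, Matrix.sub_apply, Matrix.of_apply,
        Matrix.single_apply, e1, e2]
      split_ifs <;> ring
    have hl : ∀ z, ∀ i j : Fin (n + 2), (j : ℕ) + 2 ≤ i → M z i j = 0 := fun z i j h => by
      have h1 : i ≠ j := fun h' => by subst h'; omega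
      simp only [M, Matrix.sub_apply, Matrix.of_apply, Matrix.scalar_apply,
        Matrix.diagonal_apply_ne _ h1, if_neg h1]
      rw [if_neg (by omega), if_neg (by omega)]; simp
    have hu : ∀ z, ∀ i j : Fin (n + 2), (i : ℕ) + 2 ≤ j → M z i j = 0 := fun z i j h => by
      have h1 : i ≠ j := fun h' => by subst h'; omega
      simp only [M, Matrix.sub_apply, Matrix.of_apply, Matrix.scalar_apply,
        Matrix.diagonal_apply_ne _ h1, if_neg h1]
      rw [if_neg (by omega), if_neg (by omega)]; simp
    have h1 : ∀ z, ∏ i : Fin (n + 1), M z i.succ i.castSucc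
        = (-1) ^ (n + 1) * ∏ i : Fin (n + 1), (J.a ((i : ℤ) + 1) : ℂ) := fun z => by
      have : ∀ i : Fin (n + 1), M z i.succ i.castSucc = (-1) * (J.a ((i : ℤ) + 1) : ℂ) := by
        intro i
        have hne : i.succ ≠ i.castSucc := (Fin.castSucc_lt_succ).ne'
        simp only [M, Matrix.sub_apply, Matrix.of_apply, Matrix.scalar_apply,
          Matrix.diagonal_apply_ne _ hne, if_neg hne, Fin.val_succ, Fin.val_castSucc]
        rw [if_neg (by omega), if_pos trivial]; simp
      simp only [this, Finset.prod_mul_distrib, Finset.prod_const, Finset.card_univ,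
        Fintype.card_fin]
    have h2 : ∀ z, ∏ i : Fin (n + 1), M z i.castSucc i.succ
        = (-1) ^ (n + 1) * ∏ i : Fin (n + 1), (J.a ((i : ℤ) + 1) : ℂ) := fun z => by
      have : ∀ i : Fin (n + 1), M z i.castSucc i.succ = (-1) * (J.a ((i : ℤ) + 1) : ℂ) := by
        intro i
        have hne : i.castSucc ≠ i.succ := (Fin.castSucc_lt_succ).ne
        simp only [M, Matrix.sub_apply, Matrix.of_apply, Matrix.scalar_apply,
          Matrix.diagonal_apply_ne _ hne, if_neg hne, Fin.val_succ, Fin.val_castSucc]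
        rw [if_pos trivial, if_neg (by omega)]; simp
      simp only [this, Finset.prod_mul_distrib, Finset.prod_const, Finset.card_univ,
        Fintype.card_fin]
    refine ⟨fun z => (M z).det + (J.a (n + 2 : ℕ) : ℂ) ^ 2 *
      (((M z).updateRow 0 (Pi.single (Fin.last _) 1)).updateRow (Fin.last _)
        (Pi.single 0 1)).det, fun z θ => ?_⟩
    have hexp : Complex.exp (Complex.I * θ) * Complex.exp (-(Complex.I * θ)) = 1 := by
      rw [← Complex.exp_add, add_neg_cancel, Complex.exp_zero]
    have hsq : ((-1 : ℂ) ^ (n + 1)) * (-1) ^ (n + 1) = 1 := by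
      rw [← mul_pow]; simp
    have hh : (J.hopProd (n + 2) : ℂ)
        = (∏ i : Fin (n + 1), (J.a ((i : ℤ) + 1) : ℂ)) * (J.a (n + 2 : ℕ) : ℂ) := by
      rw [hopProd, Fin.prod_univ_castSucc]
      push_cast
      congr 3
    rw [hM, Matrix.det_tridiagonal_add_corners _ (hl z) (hu z), h1, h2, hh]
    beta_reduce
    generalize (∏ i : Fin (n + 1), (J.a ((i : ℤ) + 1) : ℂ)) = P
    generalize (((M z).updateRow 0 (Pi.single (Fin.last _) 1)).updateRow (Fin.last _)
        (Pi.single 0 1)).det = E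
    generalize (J.a (n + 2 : ℕ) : ℂ) = a
    linear_combination (P * a) * hc θ + a ^ 2 * E * hexp
      - a * P * (Complex.exp (-(Complex.I * θ)) + Complex.exp (Complex.I * θ)) * hsq

/-- The enumeration of the indices of `eigenvalues` in increasing order of the eigenvalues. -/
def eigenIndex (q : ℕ) : Fin q ≃ Fin q :=
  Fin.revPerm.trans ((finCongr (Fintype.card_fin q).symm).trans
    (Fintype.equivOfCardEq (Fintype.card_fin _)))

theorem eigenvalue_eq (q : ℕ) (j : Fin q) (θ : ℝ) :
    J.eigenvalue q j θ = (J.floquet_isHermitian q θ).eigenvalues (eigenIndex q j) := by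
  simp [eigenvalue, Matrix.IsHermitian.eigenvalues, eigenIndex]

theorem eigenvalue_monotone (q : ℕ) (θ : ℝ) : Monotone fun j => J.eigenvalue q j θ :=
  fun i j hij => (J.floquet_isHermitian q θ).eigenvalues₀_antitone
    (show (Fin.cast (Fintype.card_fin q).symm j.rev) ≤ Fin.cast _ i.rev from
      Fin.rev_le_rev.2 hij)

/-- An orthonormal basis of eigenvectors of the Floquet matrix, in increasing order of the
eigenvalues. -/
def eigenbasis (q : ℕ) (θ : ℝ) : OrthonormalBasis (Fin q) ℂ (EuclideanSpace ℂ (Fin q)) :=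
  (J.floquet_isHermitian q θ).eigenvectorBasis.reindex (eigenIndex q).symm

/-- The Floquet matrix as an operator. -/
abbrev floquetOp (q : ℕ) (θ : ℝ) : EuclideanSpace ℂ (Fin q) →L[ℂ] EuclideanSpace ℂ (Fin q) :=
  Matrix.toEuclideanCLM (𝕜 := ℂ) (J.floquet q θ)

/-- The fibre of the velocity as an operator. -/
abbrev velocityOp (q : ℕ) (θ : ℝ) : EuclideanSpace ℂ (Fin q) →L[ℂ] EuclideanSpace ℂ (Fin q) :=
  Matrix.toEuclideanCLM (𝕜 := ℂ) (J.velocity q θ)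

theorem floquetOp_eigenbasis (q : ℕ) (θ : ℝ) (j : Fin q) :
    J.floquetOp q θ (J.eigenbasis q θ j)
      = (J.eigenvalue q j θ : ℂ) • J.eigenbasis q θ j := by
  have h := (J.floquet_isHermitian q θ).mulVec_eigenvectorBasis (eigenIndex q j)
  rw [← J.eigenvalue_eq] at h
  ext i
  rw [Matrix.ofLp_toEuclideanCLM]
  simp only [eigenbasis, OrthonormalBasis.reindex_apply, Equiv.symm_symm]
  rw [h]
  simp

/-- The characteristic polynomial of the Floquet matrix, as a real polynomial. -/
def bandPoly (q : ℕ) (θ : ℝ) : ℝ[X] := ∏ j : Fin q, (X - C (J.eigenvalue q j θ))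

theorem eval_bandPoly (q : ℕ) (θ x : ℝ) :
    (((J.bandPoly q θ).eval x : ℝ) : ℂ)
      = (Matrix.scalar (Fin q) (x : ℂ) - J.floquet q θ).det := by
  rw [← Matrix.eval_charpoly, (J.floquet_isHermitian q θ).charpoly_eq, bandPoly,
    eval_prod, eval_prod, ← (eigenIndex q).prod_comp (fun i => eval (x : ℂ) _)]
  simp [eigenvalue_eq]

/-- Comparing two quasimomenta eliminates the function `D`, which is not known to be a polynomial,
and leaves an identity of real polynomials. -/
theorem bandPoly_add_cos {q : ℕ} (hq : 0 < q) (θ θ' : ℝ) :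
    J.bandPoly q θ + C (2 * J.hopProd q * Real.cos θ)
      = J.bandPoly q θ' + C (2 * J.hopProd q * Real.cos θ') := by
  obtain ⟨D, hD⟩ := J.exists_det_floquet hq
  refine Polynomial.funext fun x => ?_
  apply Complex.ofReal_injective
  simp only [eval_add, eval_C, Complex.ofReal_add, eval_bandPoly, hD]
  push_cast
  ring

/-- The `θ`-independent part of the characteristic polynomial of the Floquet matrices. -/
def discriminant (q : ℕ) : ℝ[X] := J.bandPoly q 0 + C (2 * J.hopProd q)

theorem bandPoly_eq {q : ℕ} (hq : 0 < q) (θ : ℝ) :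
    J.bandPoly q θ = J.discriminant q - C (2 * J.hopProd q * Real.cos θ) := by
  have h := J.bandPoly_add_cos hq θ 0
  rw [Real.cos_zero, mul_one] at h
  rw [discriminant, ← h, add_sub_cancel_right]

theorem eval_discriminant_eigenvalue {q : ℕ} (hq : 0 < q) (θ : ℝ) (j : Fin q) :
    (J.discriminant q).eval (J.eigenvalue q j θ) = 2 * J.hopProd q * Real.cos θ := by
  have h : (J.bandPoly q θ).eval (J.eigenvalue q j θ) = 0 := by
    rw [bandPoly, eval_prod]
    exact Finset.prod_eq_zero (Finset.mem_univ j) (by simp)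
  rw [bandPoly_eq J hq, eval_sub, eval_C] at h
  linarith

/-- The Hermitian fibres at `θ = 0` and `θ = π` supply the real roots of `D - 2p` and `D + 2p`. -/
theorem le_abs_eval_discriminant {q : ℕ} (hq : 0 < q) {x : ℝ}
    (hx : (derivative (J.discriminant q)).eval x = 0) :
    2 * J.hopProd q ≤ |(J.discriminant q).eval x| := by
  refine Polynomial.le_abs_eval_of_derivative_eq_zero hq
    (r := fun j => J.eigenvalue q j 0) (s := fun j => J.eigenvalue q j Real.pi) ?_ ?_ hx
  · have := J.bandPoly_eq hq 0
    rw [Real.cos_zero, mul_one] at this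
    rw [← this, bandPoly]
  · have := J.bandPoly_eq hq Real.pi
    rw [Real.cos_pi, mul_neg_one, C_neg, sub_neg_eq_add] at this
    rw [← this, bandPoly]

end JacobiMatrix

/-- A monotone tuple containing all the values of a strictly monotone tuple of the same length is
equal to it. -/
theorem StrictMono.eq_of_monotone_of_forall_exists {q : ℕ} {f g : Fin q → ℝ} (hf : StrictMono f)
    (hg : Monotone g) (h : ∀ i, ∃ k, g k = f i) : f = g := by
  choose k hk using h
  have hkinj : Function.Injective k := fun i j hij => hf.injective (by rw [← hk, ← hk, hij])
  have hksurj : Function.Surjective k := Finite.injective_iff_surjective.1 hkinj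
  have hginj : Function.Injective g := fun x y hxy => by
    obtain ⟨i, rfl⟩ := hksurj x
    obtain ⟨j, rfl⟩ := hksurj y
    rw [hk, hk] at hxy
    rw [hf.injective hxy]
  refine (hf.range_inj (hg.strictMono_of_injective hginj)).1 (Subset.antisymm ?_ ?_)
  · rintro _ ⟨i, rfl⟩; exact ⟨k i, hk i⟩
  · rintro _ ⟨x, rfl⟩
    obtain ⟨i, rfl⟩ := hksurj x
    exact ⟨i, (hk i).symm⟩

/-! ### Bounds on the class, simplicity, gaps and continuity of the eigenvalues. -/

namespace JacobiMatrix
open Polynomial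

variable {J : JacobiMatrix} {R : ℝ}

theorem norm_op_single_apply_le (hJ : J ∈ boundedClass R) (m n : ℤ) :
    ‖J.op (lp.single (E := fun _ : ℤ => ℂ) 2 m 1) n‖ ≤ R := by
  set δ : EllTwo := lp.single (E := fun _ : ℤ => ℂ) 2 m 1
  have hδ : ‖δ‖ = 1 := by
    rw [lp.norm_single (by norm_num), norm_one]
  calc ‖J.op δ n‖ ≤ ‖J.op δ‖ := lp.norm_apply_le_norm (by norm_num) _ _
    _ ≤ ‖J.op‖ * ‖δ‖ := J.op.le_opNorm _
    _ ≤ R := by rw [hδ, mul_one]; exact hJ.1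

theorem abs_b_le (hJ : J ∈ boundedClass R) (n : ℤ) : |J.b n| ≤ R := by
  have h := norm_op_single_apply_le hJ n n
  rw [op_apply, lp.single_apply_self, lp.single_apply_ne _ _ _ (by omega),
    lp.single_apply_ne _ _ _ (by omega)] at h
  simpa using h

theorem a_pos' (J : JacobiMatrix) (n : ℤ) : 0 < J.a n := by
  obtain ⟨c, hc, h⟩ := J.a_pos
  exact hc.trans_le (h n)

theorem a_le (hJ : J ∈ boundedClass R) (n : ℤ) : J.a n ≤ R := by
  have h := norm_op_single_apply_le hJ (n + 1) n
  rw [op_apply, lp.single_apply_self, lp.single_apply_ne _ _ _ (by omega),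
    lp.single_apply_ne _ _ _ (by omega)] at h
  simpa [abs_of_pos (J.a_pos' n)] using h

theorem one_le_of_mem_boundedClass (hR : 0 < R) (hJ : J ∈ boundedClass R) : 1 ≤ R := by
  have h : R⁻¹ ≤ R := (hJ.2 0).trans (a_le hJ 0)
  by_contra! h1
  exact absurd (h.trans_lt h1) (not_lt.2 ((one_le_inv₀ hR).2 h1.le))

theorem hopProd_pos (J : JacobiMatrix) (q : ℕ) : 0 < J.hopProd q :=
  Finset.prod_pos fun _ _ => J.a_pos' _

theorem inv_pow_le_hopProd (hR : 0 < R) (hJ : J ∈ boundedClass R) (q : ℕ) :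
    (R ^ q)⁻¹ ≤ J.hopProd q := by
  have := Finset.prod_le_prod (s := (Finset.univ : Finset (Fin q))) (f := fun _ : Fin q => R⁻¹)
    (g := fun j : Fin q => J.a ((j : ℤ) + 1)) (fun _ _ => by positivity)
    (fun _ _ => hJ.2 _)
  simpa [hopProd] using this

/-- Gershgorin: a row of the Floquet matrix receives at most five contributions, each of modulus at
most `R`. -/
theorem abs_eigenvalue_le (hJ : J ∈ boundedClass R) (q : ℕ) (j : Fin q) (θ : ℝ) :
    |J.eigenvalue q j θ| ≤ 5 * R := by
  have hR : 0 ≤ R := (J.a_pos' 0).le.trans (a_le hJ 0)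
  have hev : Module.End.HasEigenvalue (Matrix.toLin' (J.floquet q θ))
      (J.eigenvalue q j θ : ℂ) := by
    refine Module.End.hasEigenvalue_of_hasEigenvector (x := ⇑(J.eigenbasis q θ j))
      ⟨Module.End.mem_eigenspace_iff.2 ?_, fun h => ?_⟩
    · rw [Matrix.toLin'_apply, ← Matrix.ofLp_toEuclideanCLM]
      exact congrArg WithLp.ofLp (J.floquetOp_eigenbasis q θ j)
    · exact (J.eigenbasis q θ).orthonormal.ne_zero j (by ext i; exact congrFun h i)
  obtain ⟨k, hk⟩ := eigenvalue_mem_ball hev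
  rw [mem_closedBall_iff_norm] at hk
  have e1 : ∀ z : ℝ, ‖Complex.exp (-(Complex.I * z))‖ = 1 := fun z => by
    have := Complex.norm_exp_ofReal_mul_I (-z)
    rwa [Complex.ofReal_neg, neg_mul, mul_comm] at this
  have e2 : ∀ z : ℝ, ‖Complex.exp (Complex.I * z)‖ = 1 := fun z => by
    rw [mul_comm]; exact Complex.norm_exp_ofReal_mul_I z
  have ha : ∀ n, |J.a n| ≤ R := fun n => by rw [abs_of_pos (J.a_pos' n)]; exact a_le hJ n
  have hrow : ∑ l, ‖J.floquet q θ k l‖ ≤ 5 * R := by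
    calc ∑ l, ‖J.floquet q θ k l‖
        ≤ ∑ l, ((if k = l then R else 0) + (if (l : ℕ) = k + 1 then R else 0)
          + (if (k : ℕ) = l + 1 then R else 0)
          + (if (k : ℕ) = 0 ∧ (l : ℕ) + 1 = q then R else 0)
          + (if (k : ℕ) + 1 = q ∧ (l : ℕ) = 0 then R else 0)) := by
          refine Finset.sum_le_sum fun l _ => ?_
          rw [floquet, Matrix.of_apply]
          refine (norm_add_le _ _).trans (add_le_add ((norm_add_le _ _).trans (add_le_add
            ((norm_add_le _ _).trans (add_le_add ((norm_add_le _ _).trans (add_le_add ?_ ?_))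
              ?_)) ?_)) ?_)
          all_goals split_ifs <;> simp [e1, e2, ha, abs_b_le hJ]
      _ ≤ R + R + R + R + R := by
          simp only [Finset.sum_add_distrib]
          gcongr <;> refine Finset.sum_ite_le_of_unique _ _ (fun i j hi hj => ?_) hR
          · rw [← hi, ← hj]
          all_goals apply Fin.ext; omega
      _ = 5 * R := by ring
  calc |J.eigenvalue q j θ| = ‖((J.eigenvalue q j θ : ℝ) : ℂ)‖ := by
        rw [Complex.norm_real, Real.norm_eq_abs]
    _ ≤ ‖J.floquet q θ k k‖ + ‖(J.eigenvalue q j θ : ℂ) - J.floquet q θ k k‖ := by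
        simpa using norm_add_le (J.floquet q θ k k)
          ((J.eigenvalue q j θ : ℂ) - J.floquet q θ k k)
    _ ≤ ‖J.floquet q θ k k‖ + ∑ l ∈ Finset.univ.erase k, ‖J.floquet q θ k l‖ := by gcongr
    _ ≤ 5 * R := by
        rwa [Finset.add_sum_erase _ (fun l => ‖J.floquet q θ k l‖) (Finset.mem_univ k)]

theorem abs_cos_lt_one {θ : ℝ} (hθ : Real.sin θ ≠ 0) : |Real.cos θ| < 1 := by
  rw [← sq_lt_one_iff_abs_lt_one]
  nlinarith [Real.sin_sq_add_cos_sq θ, sq_pos_of_ne_zero hθ]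

theorem derivative_discriminant {q : ℕ} (hq : 0 < q) (θ : ℝ) :
    derivative (J.discriminant q) = derivative (J.bandPoly q θ) := by
  rw [bandPoly_eq J hq, derivative_sub, derivative_C, sub_zero]

/-- At an eigenvalue `|D| = 2p |cos θ| < 2p`, which is below every critical value. -/
theorem derivative_discriminant_ne_zero {q : ℕ} {θ : ℝ} (hθ : Real.sin θ ≠ 0) (j : Fin q) :
    (derivative (J.discriminant q)).eval (J.eigenvalue q j θ) ≠ 0 := by
  intro h
  have hq : 0 < q := j.pos
  have h1 := J.le_abs_eval_discriminant hq h
  rw [J.eval_discriminant_eigenvalue hq, abs_mul,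
    abs_of_pos (by have := J.hopProd_pos q; positivity)] at h1
  nlinarith [J.hopProd_pos q, abs_cos_lt_one hθ]

theorem eigenvalue_strictMono {q : ℕ} {θ : ℝ} (hθ : Real.sin θ ≠ 0) :
    StrictMono fun j => J.eigenvalue q j θ := by
  refine (J.eigenvalue_monotone q θ).strictMono_of_injective fun j k hjk => ?_
  by_contra hne
  apply J.derivative_discriminant_ne_zero hθ j
  -- Coinciding eigenvalues would be a double root, hence a critical point of `D`.
  rw [derivative_discriminant j.pos θ, bandPoly, ← Finset.mul_prod_erase _ _ (Finset.mem_univ j)]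
  have : (∏ i ∈ Finset.univ.erase j, (X - C (J.eigenvalue q i θ))).eval (J.eigenvalue q j θ)
      = 0 := by
    rw [eval_prod]
    refine Finset.prod_eq_zero (Finset.mem_erase.2 ⟨Ne.symm hne, Finset.mem_univ k⟩) ?_
    simpa [sub_eq_zero] using hjk
  simp [this]

theorem sin_sq_le_mul_gap_of_lt (hR : 0 < R) (hJ : J ∈ boundedClass R) {q : ℕ} {θ : ℝ}
    (hθ : Real.sin θ ≠ 0) {j k : Fin q} (hjk : j < k) :
    Real.sin θ ^ 2 ≤ (10 * R ^ 2) ^ q * (J.eigenvalue q k θ - J.eigenvalue q j θ) := by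
  have hq : 0 < q := j.pos
  have hR1 := one_le_of_mem_boundedClass hR hJ
  have hroot : ∀ i, (J.bandPoly q θ).eval (J.eigenvalue q i θ) = 0 := fun i => by
    rw [bandPoly_eq J hq, eval_sub, eval_C, J.eval_discriminant_eigenvalue hq, sub_self]
  -- Rolle's theorem between the two eigenvalues.
  obtain ⟨x, ⟨hx1, hx2⟩, hx⟩ := exists_deriv_eq_zero (J.eigenvalue_strictMono hθ hjk)
    (J.bandPoly q θ).continuousOn (by rw [hroot, hroot])
  rw [Polynomial.deriv, ← derivative_discriminant hq θ] at hx
  have h1 := J.le_abs_eval_discriminant hq hx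
  have h2 : |(J.bandPoly q θ).eval x| ≤ (J.eigenvalue q k θ - J.eigenvalue q j θ)
      * (10 * R) ^ q := by
    -- The factor of index `j` is at most the gap; each of the others is at most `10R`, since `x`
    -- and all eigenvalues lie in `[-5R, 5R]`.
    rw [bandPoly, eval_prod, Finset.abs_prod, ← Finset.mul_prod_erase _ _ (Finset.mem_univ j)]
    have hprod : ∏ i ∈ Finset.univ.erase j, |(X - C (J.eigenvalue q i θ)).eval x|
        ≤ (10 * R) ^ q := by
      calc ∏ i ∈ Finset.univ.erase j, |(X - C (J.eigenvalue q i θ)).eval x|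
          ≤ ∏ i ∈ Finset.univ.erase j, (10 * R) := by
            refine Finset.prod_le_prod (fun _ _ => abs_nonneg _) fun i _ => ?_
            have b1 := abs_le.1 (abs_eigenvalue_le hJ q j θ)
            have b2 := abs_le.1 (abs_eigenvalue_le hJ q k θ)
            have b3 := abs_le.1 (abs_eigenvalue_le hJ q i θ)
            simp only [eval_sub, eval_X, eval_C]
            rw [abs_le]
            constructor <;> linarith [b1.1, b1.2, b2.1, b2.2, b3.1, b3.2]
        _ ≤ (10 * R) ^ q := by
            rw [Finset.prod_const]
            exact pow_le_pow_right₀ (by linarith) (by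
              simp)
    refine mul_le_mul ?_ hprod (Finset.prod_nonneg fun _ _ => abs_nonneg _) (by linarith)
    simp only [eval_sub, eval_X, eval_C]
    rw [abs_of_pos (by linarith)]
    linarith
  have h3 : |(J.discriminant q).eval x|
      ≤ |(J.bandPoly q θ).eval x| + 2 * J.hopProd q * |Real.cos θ| := by
    have hp : 0 < 2 * J.hopProd q := by have := J.hopProd_pos q; positivity
    rw [bandPoly_eq J hq, eval_sub, eval_C]
    have := abs_add_le ((J.discriminant q).eval x - 2 * J.hopProd q * Real.cos θ)
      (2 * J.hopProd q * Real.cos θ)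
    rwa [sub_add_cancel, abs_mul (2 * J.hopProd q), abs_of_pos hp] at this
  have h4 : Real.sin θ ^ 2 ≤ 2 * (1 - |Real.cos θ|) := by
    have := abs_cos_lt_one hθ
    nlinarith [Real.sin_sq_add_cos_sq θ, sq_abs (Real.cos θ), sq_nonneg (1 - |Real.cos θ|)]
  have h5 : J.hopProd q * Real.sin θ ^ 2
      ≤ (J.eigenvalue q k θ - J.eigenvalue q j θ) * (10 * R) ^ q := by
    have := mul_le_mul_of_nonneg_left h4 (J.hopProd_pos q).le
    linarith
  have h6 : (R ^ q)⁻¹ * Real.sin θ ^ 2 ≤ J.hopProd q * Real.sin θ ^ 2 := by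
    gcongr; exact inv_pow_le_hopProd hR hJ q
  have h7 : Real.sin θ ^ 2 
      ≤ R ^ q * ((J.eigenvalue q k θ - J.eigenvalue q j θ) * (10 * R) ^ q) := by
    have := h6.trans h5
    rwa [inv_mul_le_iff₀ (by positivity)] at this
  calc Real.sin θ ^ 2 ≤ _ := h7
    _ = _ := by rw [show 10 * R ^ 2 = R * (10 * R) by ring, mul_pow R]; ring

/-- Quantitative simplicity of the Floquet eigenvalues. -/
theorem sin_sq_le_mul_gap (hR : 0 < R) (hJ : J ∈ boundedClass R) {q : ℕ} {θ : ℝ}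
    (hθ : Real.sin θ ≠ 0) {j k : Fin q} (hjk : j ≠ k) :
    Real.sin θ ^ 2 ≤ (10 * R ^ 2) ^ q * |J.eigenvalue q j θ - J.eigenvalue q k θ| := by
  rcases lt_or_gt_of_ne hjk with h | h
  · rw [abs_sub_comm]
    exact (sin_sq_le_mul_gap_of_lt hR hJ hθ h).trans (by gcongr; exact le_abs_self _)
  · exact (sin_sq_le_mul_gap_of_lt hR hJ hθ h).trans (by gcongr; exact le_abs_self _)

-- The eigenvalues solve `D(λ) = 2p cos θ` with `D' ≠ 0`, so the local inverses of `D` give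
-- continuous branches of roots.
open Filter Topology in
theorem continuousAt_eigenvalue {q : ℕ} {θ₀ : ℝ} (hθ : Real.sin θ₀ ≠ 0) (j : Fin q) :
    ContinuousAt (J.eigenvalue q j) θ₀ := by
  have hq : 0 < q := j.pos
  set f : ℝ → ℝ := fun x => (J.discriminant q).eval x with hf
  set y : ℝ → ℝ := fun θ => 2 * J.hopProd q * Real.cos θ with hy
  have hfy : ∀ i, f (J.eigenvalue q i θ₀) = y θ₀ := J.eval_discriminant_eigenvalue hq θ₀
  have hd : ∀ i, HasStrictDerivAt f _ (J.eigenvalue q i θ₀) := fun i =>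
    (J.discriminant q).hasStrictDerivAt _
  have hne : ∀ i, (derivative (J.discriminant q)).eval (J.eigenvalue q i θ₀) ≠ 0 :=
    fun i => derivative_discriminant_ne_zero hθ i
  set g : Fin q → ℝ → ℝ := fun i => (hd i).localInverse f _ _ (hne i)
  have hyc : ContinuousAt y θ₀ := by fun_prop
  have hg0 : ∀ i, g i (y θ₀) = J.eigenvalue q i θ₀ := fun i => by
    rw [← hfy i]; exact ((hd i).eventually_left_inverse (hne i)).self_of_nhds
  have hgc : ∀ i, ContinuousAt (fun θ => g i (y θ)) θ₀ := fun i => by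
    refine ContinuousAt.comp (g := g i) ?_ hyc
    have := ((hd i).to_localInverse (hne i)).hasDerivAt.continuousAt
    rwa [hfy i] at this
  have hgr : ∀ i, ∀ᶠ θ in 𝓝 θ₀, f (g i (y θ)) = y θ := fun i => by
    have := (hd i).eventually_right_inverse (hne i)
    rw [hfy i] at this
    exact hyc.eventually this
  have hlt : ∀ i k : Fin q, i < k → ∀ᶠ θ in 𝓝 θ₀, g i (y θ) < g k (y θ) := fun i k hik => by
    refine (hgc i).eventually_lt (hgc k) ?_
    rw [hg0, hg0]
    exact J.eigenvalue_strictMono hθ hik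
  -- Near `θ₀` the branches stay ordered, so they are `q` distinct roots and must agree with the
  -- sorted eigenvalues.
  have hev : ∀ᶠ θ in 𝓝 θ₀, (fun i => g i (y θ)) = fun i => J.eigenvalue q i θ := by
    filter_upwards [eventually_all.2 hgr, eventually_all.2 fun i => eventually_all.2 fun k =>
      eventually_all.2 (hlt i k)] with θ h1 h2
    refine StrictMono.eq_of_monotone_of_forall_exists (fun i k hik => h2 i k hik)
      (J.eigenvalue_monotone q θ) fun i => ?_
    have h3 : (J.bandPoly q θ).eval (g i (y θ)) = 0 := by
      rw [bandPoly_eq J hq, eval_sub, eval_C, sub_eq_zero]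
      exact h1 i
    rw [bandPoly, eval_prod, Finset.prod_eq_zero_iff] at h3
    obtain ⟨k, -, hk⟩ := h3
    refine ⟨k, ?_⟩
    simp only [eval_sub, eval_X, eval_C] at hk
    linarith
  exact (hgc j).congr (hev.mono fun θ h => congrFun h j)

end JacobiMatrix

/-! ### The Feynman–Hellmann formula. -/

section EigenbasisPerturbation
open Filter Topology

variable {ι E : Type*} [Fintype ι] [NormedAddCommGroup E] [InnerProductSpace ℂ E]

theorem OrthonormalBasis.inner_apply_of_eigen (u : OrthonormalBasis ι ℂ E) {T : E →L[ℂ] E}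
    {l : ι → ℂ} (hT : ∀ i, T (u i) = l i • u i) (k : ι) (x : E) :
    inner ℂ (u k) (T x) = l k * inner ℂ (u k) x := by
  classical
  conv_lhs => rw [← u.sum_repr x]
  simp only [map_sum, map_smul, hT, inner_sum, inner_smul_right,
    orthonormal_iff_ite.1 u.orthonormal, mul_ite, mul_one, mul_zero, Finset.sum_ite_eq,
    Finset.mem_univ, if_true, u.repr_apply_apply]
  ring

/-- The Feynman–Hellmann formula for a family of operators with a real eigenbasis, at a parameter
at which the eigenvalues are continuous and simple. -/
theorem exists_hasDerivAt_eigenvalue {H : ℝ → E →L[ℂ] E} {H' : E →L[ℂ] E} {s₀ : ℝ}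
    (hH : HasDerivAt H H' s₀) (u : ℝ → OrthonormalBasis ι ℂ E) (l : ι → ℝ → ℝ)
    (hu : ∀ s i, H s (u s i) = (l i s : ℂ) • u s i) (hl : ∀ i, ContinuousAt (l i) s₀)
    (hinj : Function.Injective fun i => l i s₀) (j : ι) :
    ∃ d : ℝ, (d : ℂ) = inner ℂ (u s₀ j) (H' (u s₀ j)) ∧ HasDerivAt (l j) d s₀ := by
  set w := u s₀ j with hw
  have hHw : HasDerivAt (fun s => H s w) (H' w) s₀ := by
    exact ((ContinuousLinearMap.apply ℂ E w).restrictScalars ℝ).hasFDerivAt.comp_hasDerivAt s₀ hH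
  have hf : HasDerivAt (fun s => inner ℂ w (H s w)) (inner ℂ w (H' w)) s₀ := by
    simpa using (hasDerivAt_const s₀ w).inner ℂ hHw
  set c : ι → ℝ → ℂ := fun k s => inner ℂ (u s k) w with hc
  have hcsum : ∀ s, ∑ k, ‖c k s‖ ^ 2 = 1 := fun s => by
    rw [(u s).sum_sq_norm_inner_right, hw, (u s₀).orthonormal.1 j, one_pow]
  have hexp : ∀ s, inner ℂ w (H s w) = ((∑ k, l k s * ‖c k s‖ ^ 2 : ℝ) : ℂ) := fun s => by
    rw [← (u s).sum_inner_mul_inner]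
    push_cast
    refine Finset.sum_congr rfl fun k _ => ?_
    rw [(u s).inner_apply_of_eigen (hu s), ← inner_conj_symm w, ← Complex.conj_mul']
    ring
  have hcomm : ∀ s k, inner ℂ (u s k) (H s w - H s₀ w) = ((l k s - l j s₀ : ℝ) : ℂ) * c k s := by
    intro s k
    rw [inner_sub_right, (u s).inner_apply_of_eigen (hu s), hw, hu, inner_smul_right]
    push_cast; ring
  -- The eigenvectors `u s` may vary discontinuously, so they are never differentiated. For `k ≠ j`,
  -- `hcomm` bounds `c k s` by a multiple of `‖H s w - H s₀ w‖ = O(|s - s₀|)`, so the weight `‖c k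
  -- s‖²` is of second order.
  have hterm : ∀ k, HasDerivAt (fun s => (l k s - l j s) * ‖c k s‖ ^ 2) 0 s₀ := by
    intro k
    by_cases hkj : k = j
    · subst hkj; simpa using hasDerivAt_const s₀ (0 : ℝ)
    have hne : l k s₀ - l j s₀ ≠ 0 := sub_ne_zero.2 fun h => hkj (hinj h)
    have hck : c k s₀ = 0 := (u s₀).orthonormal.2 hkj
    rw [hasDerivAt_iff_isLittleO]
    simp only [hck, norm_zero, smul_zero, sub_zero, ne_eq, OfNat.ofNat_ne_zero,
      not_false_eq_true, zero_pow, mul_zero]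
    have hb : ContinuousAt (fun s => |l k s - l j s| / (l k s - l j s₀) ^ 2) s₀ := by
      refine ContinuousAt.div₀ (((hl k).sub (hl j)).abs) (((hl k).sub continuousAt_const).pow 2)
        (pow_ne_zero 2 hne)
    have h1 : (fun s => |l k s - l j s| / (l k s - l j s₀) ^ 2 * ‖H s w - H s₀ w‖ ^ 2)
        =O[𝓝 s₀] fun s => (1 : ℝ) * ‖s - s₀‖ ^ 2 :=
      (hb.isBigO_one ℝ).mul ((hHw.isBigO_sub.norm_norm).pow 2)
    have h2 : (fun s => (1 : ℝ) * ‖s - s₀‖ ^ 2) =o[𝓝 s₀] fun s => s - s₀ := by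
      simp only [one_mul]
      have := Asymptotics.isLittleO_norm_pow_id (E' := ℝ) (n := 2) one_lt_two
      exact this.comp_tendsto (tendsto_sub_nhds_zero_iff.2 tendsto_id)
    refine (Asymptotics.IsBigO.trans_isLittleO ?_ h2)
    refine Asymptotics.IsBigO.trans ?_ h1
    refine Asymptotics.IsBigO.of_bound 1 ?_
    have hev : ∀ᶠ s in 𝓝 s₀, l k s - l j s₀ ≠ 0 :=
      ((hl k).sub continuousAt_const).eventually_ne hne
    filter_upwards [hev] with s hs
    have h3 : |l k s - l j s₀| * ‖c k s‖ ≤ ‖H s w - H s₀ w‖ := by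
      have := norm_inner_le_norm (𝕜 := ℂ) (u s k) (H s w - H s₀ w)
      rwa [hcomm, norm_mul, Complex.norm_real, (u s).orthonormal.1 k, one_mul] at this
    have h4 : (l k s - l j s₀) ^ 2 * ‖c k s‖ ^ 2 ≤ ‖H s w - H s₀ w‖ ^ 2 := by
      rw [← sq_abs (l k s - l j s₀), ← mul_pow]
      exact pow_le_pow_left₀ (by positivity) h3 2
    have hs2 : 0 < (l k s - l j s₀) ^ 2 := sq_pos_of_ne_zero hs
    rw [one_mul, norm_mul, Real.norm_eq_abs, Real.norm_of_nonneg (by positivity),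
      Real.norm_of_nonneg (by positivity), div_mul_eq_mul_div, le_div_iff₀ hs2, mul_assoc]
    gcongr
    linarith
  have hg : HasDerivAt (fun s => ∑ k, (l k s - l j s) * ‖c k s‖ ^ 2) 0 s₀ := by
    simpa using HasDerivAt.fun_sum fun k (_ : k ∈ Finset.univ) => hterm k
  have hr : HasDerivAt (fun s => ∑ k, l k s * ‖c k s‖ ^ 2) (inner ℂ w (H' w)).re s₀ := by
    have := (Complex.reCLM.hasFDerivAt.comp_hasDerivAt s₀ hf)
    refine this.congr_of_eventuallyEq (Eventually.of_forall fun s => ?_)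
    simp only [Function.comp, hexp, Complex.reCLM_apply, Complex.ofReal_re]
  refine ⟨(inner ℂ w (H' w)).re, ?_, ?_⟩
  · have h1 := hr.ofReal_comp
    simp only [← hexp] at h1
    exact h1.unique hf
  · have h1 := hr.sub hg
    rw [sub_zero] at h1
    refine h1.congr_of_eventuallyEq (Eventually.of_forall fun s => ?_)
    simp only [Pi.sub_apply, sub_mul, Finset.sum_sub_distrib, ← Finset.mul_sum, hcsum]
    ring

end EigenbasisPerturbation

/-! ### The velocity as a quasimomentum derivative. -/

namespace JacobiMatrix

variable (J : JacobiMatrix) (q : ℕ)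

/-- The corner entry of the Floquet matrices that carries the factor `e^{-iθ}`. -/
def upperCorner : Matrix (Fin q) (Fin q) ℂ :=
  Matrix.of fun j k => if (j : ℕ) = 0 ∧ (k : ℕ) + 1 = q then (J.a q : ℂ) else 0

/-- The corner entry of the Floquet matrices that carries the factor `e^{iθ}`. -/
def lowerCorner : Matrix (Fin q) (Fin q) ℂ :=
  Matrix.of fun j k => if (j : ℕ) + 1 = q ∧ (k : ℕ) = 0 then (J.a q : ℂ) else 0

/-- The part of the Floquet matrix that does not depend on the quasimomentum. -/
def floquetBase : Matrix (Fin q) (Fin q) ℂ :=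
  Matrix.of fun j k =>
    (if j = k then (J.b ((j : ℤ) + 1) : ℂ) else 0)
    + (if (k : ℕ) = j + 1 then (J.a ((j : ℤ) + 1) : ℂ) else 0)
    + (if (j : ℕ) = k + 1 then (J.a ((k : ℤ) + 1) : ℂ) else 0)

/-- The part of the velocity that does not depend on the quasimomentum. -/
def velocityBase : Matrix (Fin q) (Fin q) ℂ :=
  Matrix.of fun j k =>
    (if (k : ℕ) = j + 1 then Complex.I * (J.a ((j : ℤ) + 1) : ℂ) else 0)
    + (if (j : ℕ) = k + 1 then -(Complex.I * (J.a ((k : ℤ) + 1) : ℂ)) else 0)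

/-- The derivative of the Floquet matrix in the quasimomentum. -/
def floquetDeriv (θ : ℝ) : Matrix (Fin q) (Fin q) ℂ :=
  (-(Complex.I * Complex.exp (-(Complex.I * θ)))) • J.upperCorner q
    + (Complex.I * Complex.exp (Complex.I * θ)) • J.lowerCorner q

theorem floquet_eq (θ : ℝ) : J.floquet q θ = J.floquetBase q
    + Complex.exp (-(Complex.I * θ)) • J.upperCorner q
    + Complex.exp (Complex.I * θ) • J.lowerCorner q := by
  ext j k
  simp [floquet, floquetBase, upperCorner, lowerCorner]

theorem velocity_eq (θ : ℝ) : J.velocity q θ = J.velocityBase q + J.floquetDeriv q θ := by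
  ext j k
  simp [velocity, velocityBase, floquetDeriv, upperCorner, lowerCorner, add_assoc]
  split_ifs <;> simp

theorem hasDerivAt_floquetOp (θ : ℝ) :
    HasDerivAt (J.floquetOp q) (Matrix.toEuclideanCLM (𝕜 := ℂ) (J.floquetDeriv q θ)) θ := by
  have e : J.floquetOp q = fun θ : ℝ => Matrix.toEuclideanCLM (𝕜 := ℂ) (J.floquetBase q)
      + Complex.exp (-(Complex.I * θ)) • Matrix.toEuclideanCLM (𝕜 := ℂ) (J.upperCorner q)
      + Complex.exp (Complex.I * θ) • Matrix.toEuclideanCLM (𝕜 := ℂ) (J.lowerCorner q) := by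
    funext θ
    rw [floquetOp, floquet_eq, map_add, map_add, map_smul, map_smul]
  have h0 : HasDerivAt (fun θ : ℝ => Complex.I * (θ : ℂ)) Complex.I θ := by
    simpa using (Complex.ofRealCLM.hasDerivAt (x := θ)).const_mul Complex.I
  have h1 := h0.neg.cexp.smul_const (Matrix.toEuclideanCLM (𝕜 := ℂ) (J.upperCorner q))
  have h2 := h0.cexp.smul_const (Matrix.toEuclideanCLM (𝕜 := ℂ) (J.lowerCorner q))
  rw [e]
  refine ((h1.const_add (Matrix.toEuclideanCLM (𝕜 := ℂ) (J.floquetBase q))).add h2).congr_deriv ?_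
  rw [floquetDeriv, map_add, map_smul, map_smul]
  congr 2
  · simp only [Pi.neg_apply]; ring_nf
  · ring_nf

theorem continuous_floquetOp : Continuous (J.floquetOp q) :=
  continuous_iff_continuousAt.2 fun θ => (J.hasDerivAt_floquetOp q θ).continuousAt

theorem continuous_velocityOp : Continuous (J.velocityOp q) := by
  have e : J.velocityOp q = fun θ : ℝ => Matrix.toEuclideanCLM (𝕜 := ℂ) (J.velocityBase q)
      + ((-(Complex.I * Complex.exp (-(Complex.I * θ)))) •
          Matrix.toEuclideanCLM (𝕜 := ℂ) (J.upperCorner q)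
      + (Complex.I * Complex.exp (Complex.I * θ)) •
          Matrix.toEuclideanCLM (𝕜 := ℂ) (J.lowerCorner q)) := by
    funext θ
    rw [velocityOp, velocity_eq, floquetDeriv, map_add, map_add, map_smul, map_smul]
  rw [e]
  fun_prop

/-- The velocity is the commutator with the position in the unit cell, plus `q` times the
derivative in the quasimomentum. -/
theorem velocity_eq_commutator (θ : ℝ) : J.velocity q θ =
    Complex.I • (J.floquet q θ * Matrix.diagonal (fun j : Fin q => ((j : ℕ) : ℂ))
      - Matrix.diagonal (fun j : Fin q => ((j : ℕ) : ℂ)) * J.floquet q θ)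
    + (q : ℂ) • J.floquetDeriv q θ := by
  ext j k
  simp only [velocity, floquetDeriv, upperCorner, lowerCorner, Matrix.add_apply,
    Matrix.smul_apply, Matrix.sub_apply, Matrix.mul_diagonal, Matrix.diagonal_mul, smul_eq_mul,
    Matrix.of_apply, floquet]
  have e0 : ∀ x : ℂ, (if j = k then x else 0) * ((k : ℕ) : ℂ)
      = ((j : ℕ) : ℂ) * (if j = k then x else 0) := fun x => by
    split_ifs with h
    · rw [h]; ring
    · ring
  have e1 : ∀ x : ℂ, (if (k : ℕ) = j + 1 then x else 0) * ((k : ℕ) : ℂ)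
      = (((j : ℕ) : ℂ) + 1) * (if (k : ℕ) = j + 1 then x else 0) := fun x => by
    split_ifs with h
    · rw [h]; push_cast; ring
    · ring
  have e2 : ∀ x : ℂ, ((j : ℕ) : ℂ) * (if (j : ℕ) = k + 1 then x else 0)
      = (((k : ℕ) : ℂ) + 1) * (if (j : ℕ) = k + 1 then x else 0) := fun x => by
    split_ifs with h
    · rw [h]; push_cast; ring
    · ring
  have hq : ∀ {n : ℕ}, n + 1 = q → (n : ℂ) = (q : ℂ) - 1 := fun h => by
    rw [eq_sub_iff_add_eq]; exact_mod_cast h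
  -- The corners join positions `0` and `q - 1`, so the commutator gives them weight `q - 1` with
  -- the sign opposite to the velocity; adding `q` times the derivative leaves weight `1`.
  have e3 : ∀ x : ℂ, (if (j : ℕ) = 0 ∧ (k : ℕ) + 1 = q then x else 0) * ((k : ℕ) : ℂ)
      = ((q : ℂ) - 1) * (if (j : ℕ) = 0 ∧ (k : ℕ) + 1 = q then x else 0) := fun x => by
    split_ifs with h
    · rw [hq h.2]; ring
    · ring
  have e3' : ∀ x : ℂ, ((j : ℕ) : ℂ) * (if (j : ℕ) = 0 ∧ (k : ℕ) + 1 = q then x else 0) = 0 :=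
    fun x => by
      split_ifs with h
      · rw [h.1]; simp
      · ring
  have e4 : ∀ x : ℂ, ((j : ℕ) : ℂ) * (if (j : ℕ) + 1 = q ∧ (k : ℕ) = 0 then x else 0)
      = ((q : ℂ) - 1) * (if (j : ℕ) + 1 = q ∧ (k : ℕ) = 0 then x else 0) := fun x => by
    split_ifs with h
    · rw [hq h.1]
    · ring
  have e4' : ∀ x : ℂ, (if (j : ℕ) + 1 = q ∧ (k : ℕ) = 0 then x else 0) * ((k : ℕ) : ℂ) = 0 :=
    fun x => by
      split_ifs with h
      · rw [h.2]; simp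
      · ring
  rw [add_mul, add_mul, add_mul, add_mul, mul_add, mul_add, mul_add, mul_add, e0, e1, e2, e3, e3',
    e4, e4']
  have e5 : ∀ x : ℂ, (if (j : ℕ) = k + 1 then x else 0) * ((k : ℕ) : ℂ)
      = ((k : ℕ) : ℂ) * (if (j : ℕ) = k + 1 then x else 0) := fun x => mul_comm _ _
  rw [e5]
  generalize ((j : ℕ) : ℂ) = x, ((k : ℕ) : ℂ) = y
  split_ifs <;> ring

theorem inner_velocityOp_eigenbasis {θ : ℝ} (j : Fin q) :
    inner ℂ (J.eigenbasis q θ j) (J.velocityOp q θ (J.eigenbasis q θ j))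
      = q * inner ℂ (J.eigenbasis q θ j)
        (Matrix.toEuclideanCLM (𝕜 := ℂ) (J.floquetDeriv q θ) (J.eigenbasis q θ j)) := by
  have hu := (J.eigenbasis q θ).inner_apply_of_eigen (J.floquetOp_eigenbasis q θ) j
  rw [velocityOp, velocity_eq_commutator, map_add, map_smul, map_smul, map_sub, map_mul, map_mul]
  simp only [add_apply, smul_apply,
    sub_apply, mul_apply_eq_comp, inner_add_right,
    inner_smul_right, inner_sub_right, hu, floquetOp_eigenbasis, map_smul, sub_self, mul_zero,
    zero_add]

/-- The Floquet eigenvalues are differentiable away from `0` and `π`, with derivative the diagonal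
matrix elements of the velocity divided by `q`. -/
theorem exists_hasDerivAt_floquet_eigenvalue {q : ℕ} {θ : ℝ} (hθ : Real.sin θ ≠ 0) (j : Fin q) :
    ∃ d : ℝ, (q : ℂ) * d
      = inner ℂ (J.eigenbasis q θ j) (J.velocityOp q θ (J.eigenbasis q θ j)) ∧
      HasDerivAt (J.eigenvalue q j) d θ := by
  obtain ⟨d, hd, h⟩ := exists_hasDerivAt_eigenvalue (J.hasDerivAt_floquetOp q θ)
    (J.eigenbasis q) (J.eigenvalue q) (fun s i => J.floquetOp_eigenbasis q s i)
    (fun i => continuousAt_eigenvalue hθ i) (eigenvalue_strictMono hθ).injective j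
  exact ⟨d, by rw [hd, inner_velocityOp_eigenbasis], h⟩

end JacobiMatrix

/-! ### Time averages in the eigenbasis. -/

section
variable {ι E : Type*} [Fintype ι] [NormedAddCommGroup E] [InnerProductSpace ℂ E]

/-- A crude bound, but it loses only powers of the dimension, which `C₁ ^ q` absorbs. -/
theorem OrthonormalBasis.opNorm_le_sum_norm_inner (u : OrthonormalBasis ι ℂ E) (T : E →L[ℂ] E) :
    ‖T‖ ≤ ∑ k, ∑ j, ‖inner ℂ (u j) (T (u k))‖ := by
  have hcol : ∀ x : E, ‖x‖ ≤ ∑ j, ‖inner ℂ (u j) x‖ := fun x => by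
    conv_lhs => rw [← u.sum_repr' x]
    refine (norm_sum_le _ _).trans (Finset.sum_le_sum fun j _ => ?_)
    rw [norm_smul, u.orthonormal.1 j, mul_one]
  refine T.opNorm_le_bound (Finset.sum_nonneg fun _ _ => Finset.sum_nonneg fun _ _ =>
    norm_nonneg _) fun x => ?_
  calc ‖T x‖ = ‖∑ k, inner ℂ (u k) x • T (u k)‖ := by
        conv_lhs => rw [← u.sum_repr' x]
        simp only [map_sum, map_smul]
    _ ≤ ∑ k, ‖x‖ * ∑ j, ‖inner ℂ (u j) (T (u k))‖ := by
        refine (norm_sum_le _ _).trans (Finset.sum_le_sum fun k _ => ?_)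
        rw [norm_smul]
        refine mul_le_mul ?_ (hcol _) (norm_nonneg _) (norm_nonneg _)
        have := norm_inner_le_norm (𝕜 := ℂ) (u k) x
        rwa [u.orthonormal.1 k, one_mul] at this
    _ = _ := by rw [← Finset.mul_sum, mul_comm]

theorem NormedSpace.exp_apply_of_eigen [CompleteSpace E] {T : E →L[ℂ] E} {v : E} {μ : ℂ}
    (h : T v = μ • v) : NormedSpace.exp T v = Complex.exp μ • v := by
  have h1 := (NormedSpace.exp_series_hasSum_exp' (𝕂 := ℂ) T).mapL
    (ContinuousLinearMap.apply ℂ E v)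
  have h2 := (NormedSpace.exp_series_hasSum_exp' (𝕂 := ℂ) μ).smul_const v
  rw [← Complex.exp_eq_exp_ℂ] at h2
  have hpow : ∀ n : ℕ, (T ^ n) v = μ ^ n • v := fun n => by
    induction n with
    | zero => simp
    | succ n ih => rw [pow_succ', mul_apply_eq_comp, ih, map_smul, h, smul_smul, pow_succ]
  have e : (fun n : ℕ => ContinuousLinearMap.apply ℂ E v ((n.factorial⁻¹ : ℂ) • T ^ n))
      = fun n : ℕ => ((n.factorial⁻¹ : ℂ) • μ ^ n) • v := by
    funext n
    simp [hpow, smul_smul]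
  rw [e] at h1
  exact h1.unique h2

end

/-- The time average of a pure oscillation. -/
theorem norm_average_exp_le {δ t : ℝ} (hδ : δ ≠ 0) (ht : 0 < t) :
    ‖((t⁻¹ : ℝ) : ℂ) * ∫ s in (0 : ℝ)..t, Complex.exp (Complex.I * s * δ)‖
      ≤ (2 / (t * |δ|)) ^ (1 / 5 : ℝ) := by
  have hn : ∀ s : ℝ, ‖Complex.exp (Complex.I * s * δ)‖ = 1 := fun s => by
    rw [← Complex.norm_exp_ofReal_mul_I (s * δ)]; push_cast; ring_nf
  have h1 : ‖((t⁻¹ : ℝ) : ℂ) * ∫ s in (0 : ℝ)..t, Complex.exp (Complex.I * s * δ)‖ ≤ 1 := by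
    rw [norm_mul, Complex.norm_real, Real.norm_of_nonneg (by positivity), inv_mul_le_iff₀ ht,
      mul_one]
    have := intervalIntegral.norm_integral_le_of_norm_le_const (a := 0) (b := t)
      (fun s _ => (hn s).le)
    rwa [one_mul, sub_zero, abs_of_pos ht] at this
  have h2 : ‖((t⁻¹ : ℝ) : ℂ) * ∫ s in (0 : ℝ)..t, Complex.exp (Complex.I * s * δ)‖
      ≤ 2 / (t * |δ|) := by
    have hc : Complex.I * δ ≠ 0 := mul_ne_zero Complex.I_ne_zero (by exact_mod_cast hδ)
    have e : ∫ s in (0 : ℝ)..t, Complex.exp (Complex.I * s * δ)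
        = (Complex.exp (Complex.I * t * δ) - 1) / (Complex.I * δ) := by
      have := integral_exp_mul_complex (a := 0) (b := t) hc
      simp only [Complex.ofReal_zero, mul_zero, Complex.exp_zero] at this
      convert this using 4 <;> ring_nf
    rw [e, norm_mul, norm_div, norm_mul, Complex.norm_I, one_mul, Complex.norm_real,
      Complex.norm_real, Real.norm_of_nonneg (by positivity), Real.norm_eq_abs,
      show 2 / (t * |δ|) = t⁻¹ * (2 / |δ|) by field_simp]
    gcongr
    refine (norm_sub_le _ _).trans ?_
    rw [hn, norm_one]; norm_num
  -- A number in `[0, 1]` is at most its power `1/5`. With gaps of order `sin² θ`, the squared bound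
  -- is of order `|sin θ|^{-4/5}`; any positive exponent below `1/4` would keep it integrable.
  calc _ ≤ _ := Real.self_le_rpow_of_le_one (norm_nonneg _) h1 (by norm_num : (1 / 5 : ℝ) ≤ 1)
    _ ≤ _ := Real.rpow_le_rpow (norm_nonneg _) h2 (by norm_num)

namespace JacobiMatrix

variable {J : JacobiMatrix} {q : ℕ}

theorem continuous_heisenberg (J : JacobiMatrix) (q : ℕ) :
    Continuous (Function.uncurry (J.heisenberg q)) := by
  let _ : NormedAlgebra ℚ (EuclideanSpace ℂ (Fin q) →L[ℂ] EuclideanSpace ℂ (Fin q)) :=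
    NormedAlgebra.restrictScalars ℚ ℂ _
  have h1 : Continuous fun p : ℝ × ℝ => (Complex.I * (p.2 : ℂ)) • J.floquetOp q p.1 :=
    (by fun_prop : Continuous fun p : ℝ × ℝ => Complex.I * (p.2 : ℂ)).smul
      ((J.continuous_floquetOp q).comp continuous_fst)
  exact ((NormedSpace.exp_continuous.comp h1).mul
    ((J.continuous_velocityOp q).comp continuous_fst)).mul
      (NormedSpace.exp_continuous.comp h1.neg)

theorem continuous_averagedVelocity (J : JacobiMatrix) (q : ℕ) (t : ℝ) :
    Continuous fun θ => J.averagedVelocity q θ t := by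
  have h := intervalIntegral.continuous_parametric_intervalIntegral_of_continuous'
    (μ := volume) (f := J.heisenberg q) (J.continuous_heisenberg q) 0 t
  unfold averagedVelocity
  exact h.const_smul ((t⁻¹ : ℝ) : ℂ)

theorem inner_heisenberg_eigenbasis (θ s : ℝ) (j k : Fin q) :
    inner ℂ (J.eigenbasis q θ j) (J.heisenberg q θ s (J.eigenbasis q θ k))
      = Complex.exp (Complex.I * s * (J.eigenvalue q j θ - J.eigenvalue q k θ : ℝ))
        * inner ℂ (J.eigenbasis q θ j) (J.velocityOp q θ (J.eigenbasis q θ k)) := by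
  have h1 : ∀ i, NormedSpace.exp ((Complex.I * (s : ℂ)) • J.floquetOp q θ) (J.eigenbasis q θ i)
      = Complex.exp (Complex.I * s * J.eigenvalue q i θ) • J.eigenbasis q θ i := fun i =>
    NormedSpace.exp_apply_of_eigen (by
      rw [smul_apply, floquetOp_eigenbasis, smul_smul])
  have h2 : NormedSpace.exp (-((Complex.I * (s : ℂ)) • J.floquetOp q θ)) (J.eigenbasis q θ k)
      = Complex.exp (-(Complex.I * s * J.eigenvalue q k θ)) • J.eigenbasis q θ k :=
    NormedSpace.exp_apply_of_eigen (by
      rw [neg_apply, smul_apply, floquetOp_eigenbasis, smul_smul, neg_smul])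
  rw [heisenberg, mul_apply_eq_comp, mul_apply_eq_comp, h2,
    (J.eigenbasis q θ).inner_apply_of_eigen h1, map_smul, inner_smul_right, ← mul_assoc,
    ← Complex.exp_add]
  push_cast
  ring_nf

theorem inner_averagedVelocity_eigenbasis (θ t : ℝ) (j k : Fin q) :
    inner ℂ (J.eigenbasis q θ j) (J.averagedVelocity q θ t (J.eigenbasis q θ k))
      = (((t⁻¹ : ℝ) : ℂ) * ∫ s in (0 : ℝ)..t,
          Complex.exp (Complex.I * s * (J.eigenvalue q j θ - J.eigenvalue q k θ : ℝ)))
        * inner ℂ (J.eigenbasis q θ j) (J.velocityOp q θ (J.eigenbasis q θ k)) := by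
  have hc : Continuous (J.heisenberg q θ) := (J.continuous_heisenberg q).uncurry_left θ
  have h := (innerSL ℂ (J.eigenbasis q θ j)).comp (ContinuousLinearMap.apply ℂ _
    (J.eigenbasis q θ k)) |>.intervalIntegral_comp_comm (hc.intervalIntegrable (μ := volume) 0 t)
  simp only [ContinuousLinearMap.comp_apply, ContinuousLinearMap.apply_apply,
    innerSL_apply_apply] at h
  simp only [inner_heisenberg_eigenbasis] at h
  rw [averagedVelocity, smul_apply, inner_smul_right, ← h, intervalIntegral.integral_mul_const,
    mul_assoc]

theorem eigenprojection_eigenbasis {θ : ℝ} (hθ : Real.sin θ ≠ 0) (j k : Fin q) :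
    J.eigenprojection q j θ (J.eigenbasis q θ k)
      = if j = k then J.eigenbasis q θ k else 0 := by
  rw [eigenprojection]
  split_ifs with h
  · subst h
    rw [Submodule.starProjection_eq_self_iff, Module.End.mem_eigenspace_iff]
    exact J.floquetOp_eigenbasis q θ j
  · rw [Submodule.starProjection_apply_eq_zero_iff, Submodule.mem_orthogonal']
    intro v hv
    rw [Module.End.mem_eigenspace_iff] at hv
    have h1 := (J.eigenbasis q θ).inner_apply_of_eigen (J.floquetOp_eigenbasis q θ) k v
    rw [show J.floquetOp q θ v = (J.eigenvalue q j θ : ℂ) • v from hv, inner_smul_right] at h1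
    have h2 : (J.eigenvalue q j θ : ℂ) - J.eigenvalue q k θ ≠ 0 := by
      rw [sub_ne_zero, Ne, Complex.ofReal_inj]
      exact fun h' => h ((eigenvalue_strictMono hθ).injective h')
    exact (mul_eq_zero.1 (by rw [sub_mul, h1, sub_self])).resolve_left h2

/-- By Feynman–Hellmann, `Q_θ` is the diagonal part of the velocity. -/
theorem asymptoticVelocity_eigenbasis {θ : ℝ} (hθ : Real.sin θ ≠ 0) (k : Fin q) :
    J.asymptoticVelocity q θ (J.eigenbasis q θ k)
      = inner ℂ (J.eigenbasis q θ k) (J.velocityOp q θ (J.eigenbasis q θ k))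
        • J.eigenbasis q θ k := by
  obtain ⟨d, hd, hderiv⟩ := J.exists_hasDerivAt_floquet_eigenvalue hθ k
  rw [← hd, asymptoticVelocity, smul_apply, sum_apply]
  simp only [smul_apply, eigenprojection_eigenbasis hθ, smul_ite, smul_zero, Finset.sum_ite_eq',
    Finset.mem_univ, if_true, hderiv.deriv, smul_smul]

theorem norm_velocityOp_le {R : ℝ} (hJ : J ∈ boundedClass R) (q : ℕ) (θ : ℝ) :
    ‖J.velocityOp q θ‖ ≤ q * (q * (4 * R)) := by
  have hR : 0 ≤ R := (J.a_pos' 0).le.trans (a_le hJ 0)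
  have e1 : ∀ z : ℝ, ‖Complex.exp (-(Complex.I * z))‖ = 1 := fun z => by
    have := Complex.norm_exp_ofReal_mul_I (-z)
    rwa [Complex.ofReal_neg, neg_mul, mul_comm] at this
  have e2 : ∀ z : ℝ, ‖Complex.exp (Complex.I * z)‖ = 1 := fun z => by
    rw [mul_comm]; exact Complex.norm_exp_ofReal_mul_I z
  have ha : ∀ n, |J.a n| ≤ R := fun n => by rw [abs_of_pos (J.a_pos' n)]; exact a_le hJ n
  have hentry : ∀ j k, ‖J.velocity q θ j k‖ ≤ 4 * R := fun j k => by
    rw [velocity, Matrix.of_apply, show 4 * R = R + R + R + R by ring]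
    refine (norm_add_le _ _).trans (add_le_add
      ((norm_add_le _ _).trans (add_le_add ((norm_add_le _ _).trans (add_le_add ?_ ?_))
        ?_)) ?_)
    all_goals split_ifs <;> simp [e1, e2, ha, hR]
  refine ((EuclideanSpace.basisFun (Fin q) ℂ).opNorm_le_sum_norm_inner _).trans ?_
  calc _ ≤ ∑ _k : Fin q, ∑ _j : Fin q, 4 * R := by
        refine Finset.sum_le_sum fun k _ => Finset.sum_le_sum fun j _ => ?_
        have : inner ℂ (EuclideanSpace.basisFun (Fin q) ℂ j)
            (J.velocityOp q θ (EuclideanSpace.basisFun (Fin q) ℂ k)) = J.velocity q θ j k := by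
          simp [EuclideanSpace.inner_single_left, velocityOp]
        rw [this]
        exact hentry j k
    _ = _ := by simp

theorem norm_asymptoticVelocity_sub_le {R : ℝ} (hR : 0 < R) (hJ : J ∈ boundedClass R)
    {θ t : ℝ} (hθ : Real.sin θ ≠ 0) (ht : 0 < t) :
    ‖J.asymptoticVelocity q θ - J.averagedVelocity q θ t‖
      ≤ 4 * R * q ^ 4 * (2 * (10 * R ^ 2) ^ q / (t * Real.sin θ ^ 2)) ^ (1 / 5 : ℝ) := by
  have hs : 0 < Real.sin θ ^ 2 := sq_pos_of_ne_zero hθ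
  set B := (2 * (10 * R ^ 2) ^ q / (t * Real.sin θ ^ 2)) ^ (1 / 5 : ℝ) with hB
  have hB0 : 0 ≤ B := by positivity
  refine ((J.eigenbasis q θ).opNorm_le_sum_norm_inner _).trans ?_
  calc _ ≤ ∑ _k : Fin q, ∑ _j : Fin q, B * (q * (q * (4 * R))) := by
        refine Finset.sum_le_sum fun k _ => Finset.sum_le_sum fun j _ => ?_
        rw [sub_apply, inner_sub_right, asymptoticVelocity_eigenbasis hθ,
          inner_averagedVelocity_eigenbasis, inner_smul_right]
        by_cases hjk : j = k
        -- On the diagonal the phase is `1`, so the two terms cancel exactly.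
        · subst hjk
          rw [inner_self_eq_norm_sq_to_K, (J.eigenbasis q θ).orthonormal.1 j]
          have ht' : ((t : ℝ) : ℂ) ≠ 0 := by exact_mod_cast ht.ne'
          simp [ht']
          positivity
        · rw [(J.eigenbasis q θ).orthonormal.2 hjk, mul_zero, zero_sub, norm_neg, norm_mul]
          have hδ : J.eigenvalue q j θ - J.eigenvalue q k θ ≠ 0 :=
            sub_ne_zero.2 fun h => hjk ((eigenvalue_strictMono hθ).injective h)
          refine mul_le_mul ((norm_average_exp_le hδ ht).trans ?_) ?_ (norm_nonneg _) hB0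
          · refine Real.rpow_le_rpow (by positivity) ?_ (by norm_num)
            rw [div_le_div_iff₀ (by positivity) (by positivity)]
            have := sin_sq_le_mul_gap hR hJ hθ hjk
            calc 2 * (t * Real.sin θ ^ 2) = 2 * t * Real.sin θ ^ 2 := by ring
              _ ≤ 2 * t * _ := mul_le_mul_of_nonneg_left this (by positivity)
              _ = _ := by ring
          · refine (norm_inner_le_norm _ _).trans ?_
            rw [(J.eigenbasis q θ).orthonormal.1 j, one_mul]
            refine ((J.velocityOp q θ).le_opNorm _).trans ?_
            rw [(J.eigenbasis q θ).orthonormal.1 k, mul_one]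
            exact norm_velocityOp_le hJ q θ
    _ = _ := by simp; ring

end JacobiMatrix

/-! ### Measurability and integration over the quasimomentum. -/

theorem Real.intervalIntegrable_abs_sin_rpow {r : ℝ} (hr : -1 < r) (hr0 : r ≤ 0) :
    IntervalIntegrable (fun θ => |Real.sin θ| ^ r) volume 0 (2 * Real.pi) := by
  have hπ := Real.pi_pos
  have h1 : IntervalIntegrable (fun θ => |Real.sin θ| ^ r) volume 0 (Real.pi / 2) := by
    have hg := (intervalIntegral.intervalIntegrable_rpow' (a := 0) (b := Real.pi / 2) hr).const_mul
      ((2 / Real.pi) ^ r)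
    refine hg.mono_fun
      (by fun_prop : Measurable fun θ => |Real.sin θ| ^ r).aestronglyMeasurable ?_
    rw [uIoc_of_le (by positivity)]
    refine (ae_restrict_iff' measurableSet_Ioc).2 (Filter.Eventually.of_forall fun θ hθ => ?_)
    -- Jordan's inequality `sin θ ≥ 2θ/π` compares with a power of `θ` on the first quarter period;
    -- symmetry covers the rest.
    have hs := Real.mul_le_sin hθ.1.le hθ.2
    have hθ0 := hθ.1
    have hp : 0 < 2 / Real.pi * θ := by positivity
    beta_reduce
    rw [Real.norm_of_nonneg (by positivity), Real.norm_of_nonneg (by positivity),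
      abs_of_nonneg (hp.le.trans hs), ← Real.mul_rpow (by positivity) hθ0.le]
    exact Real.rpow_le_rpow_of_nonpos hp hs hr0
  have h2 : IntervalIntegrable (fun θ => |Real.sin θ| ^ r) volume (Real.pi / 2) Real.pi := by
    have := (h1.comp_sub_left Real.pi).symm
    simp only [Real.sin_pi_sub, sub_zero] at this
    convert this using 1; ring
  have h3 := h1.trans h2
  have h4 : IntervalIntegrable (fun θ => |Real.sin θ| ^ r) volume Real.pi (2 * Real.pi) := by
    have := h3.comp_sub_right Real.pi
    simp only [Real.sin_sub_pi, abs_neg, zero_add] at this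
    convert this using 1; ring
  exact h3.trans h4

theorem Real.ae_sin_ne_zero : ∀ᵐ θ : ℝ, Real.sin θ ≠ 0 := by
  have h : {θ : ℝ | Real.sin θ = 0}.Countable := by
    refine (countable_range fun n : ℤ => (n : ℝ) * Real.pi).mono fun θ hθ => ?_
    exact Real.sin_eq_zero_iff.1 hθ
  exact h.ae_notMem volume

theorem Real.sin_ne_zero_of_mem_Ioo {θ : ℝ} (hθ : θ ∈ Ioo (0 : ℝ) (2 * Real.pi))
    (hπ : θ ≠ Real.pi) : Real.sin θ ≠ 0 := by
  rcases lt_or_gt_of_ne hπ with h | h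
  · exact (Real.sin_pos_of_pos_of_lt_pi hθ.1 h).ne'
  · have := Real.sin_pos_of_pos_of_lt_pi (x := θ - Real.pi) (by linarith) (by linarith [hθ.2])
    rw [Real.sin_sub_pi] at this
    exact (neg_pos.1 this).ne

namespace JacobiMatrix
open Filter Topology

variable {J : JacobiMatrix} {q : ℕ} {R : ℝ}

theorem tendsto_averagedVelocity (hR : 0 < R) (hJ : J ∈ boundedClass R) {θ : ℝ}
    (hθ : Real.sin θ ≠ 0) :
    Tendsto (fun n : ℕ => J.averagedVelocity q θ (n + 1)) atTop
      (𝓝 (J.asymptoticVelocity q θ)) := by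
  rw [tendsto_iff_norm_sub_tendsto_zero]
  have hs : 0 < Real.sin θ ^ 2 := sq_pos_of_ne_zero hθ
  refine squeeze_zero (g := fun n : ℕ => 4 * R * q ^ 4 *
      (2 * (10 * R ^ 2) ^ q / (((n : ℝ) + 1) * Real.sin θ ^ 2)) ^ (1 / 5 : ℝ))
    (fun _ => norm_nonneg _) (fun n => by
    rw [norm_sub_rev]
    exact norm_asymptoticVelocity_sub_le hR hJ hθ (by positivity)) ?_
  have h1 : Tendsto (fun n : ℕ => ((n : ℝ) + 1) * Real.sin θ ^ 2) atTop atTop :=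
    (tendsto_atTop_add_const_right _ _ tendsto_natCast_atTop_atTop).atTop_mul_const hs
  have h2 := (h1.const_div_atTop (2 * (10 * R ^ 2) ^ q)).rpow_const
    (p := (1 / 5 : ℝ)) (Or.inr (by norm_num))
  rw [Real.zero_rpow (by norm_num)] at h2
  simpa using h2.const_mul (4 * R * q ^ 4)

/-- `Q_θ` is an almost everywhere limit of time averages, which are continuous in `θ`; this avoids
treating the derivatives and projections separately. -/
theorem aestronglyMeasurable_asymptoticVelocity (hR : 0 < R) (hJ : J ∈ boundedClass R) (q : ℕ) :
    AEStronglyMeasurable (J.asymptoticVelocity q) volume :=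
  aestronglyMeasurable_of_tendsto_ae atTop
    (fun n : ℕ => (J.continuous_averagedVelocity q (n + 1)).aestronglyMeasurable)
    (Real.ae_sin_ne_zero.mono fun _ hθ => tendsto_averagedVelocity hR hJ hθ)

theorem sq_norm_asymptoticVelocity_sub_le (hR : 0 < R) (hJ : J ∈ boundedClass R)
    {θ t : ℝ} (hθ : Real.sin θ ≠ 0) (ht : 0 < t) :
    ‖J.asymptoticVelocity q θ - J.averagedVelocity q θ t‖ ^ 2
      ≤ (4 * R * q ^ 4 * (2 * (10 * R ^ 2) ^ q / t) ^ (1 / 5 : ℝ)) ^ 2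
        * |Real.sin θ| ^ (-(4 / 5) : ℝ) := by
  have h := norm_asymptoticVelocity_sub_le (q := q) hR hJ hθ ht
  have hs : 0 < |Real.sin θ| := abs_pos.2 hθ
  refine (pow_le_pow_left₀ (norm_nonneg _) h 2).trans (le_of_eq ?_)
  rw [← div_div, Real.div_rpow (by positivity) (by positivity), ← mul_div_assoc, div_pow,
    Real.rpow_neg hs.le, ← sq_abs (Real.sin θ), ← Real.rpow_natCast (|Real.sin θ|) 2,
    ← Real.rpow_mul hs.le, ← Real.rpow_natCast (|Real.sin θ| ^ _) 2, ← Real.rpow_mul hs.le]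
  norm_num [div_eq_mul_inv]

theorem intervalIntegrable_sq_norm_sub (hR : 0 < R) (hJ : J ∈ boundedClass R) (q : ℕ) {t : ℝ}
    (ht : 0 < t) :
    IntervalIntegrable (fun θ => ‖J.asymptoticVelocity q θ - J.averagedVelocity q θ t‖ ^ 2)
      volume 0 (2 * Real.pi) := by
  have hg := (Real.intervalIntegrable_abs_sin_rpow (r := -(4 / 5)) (by norm_num)
    (by norm_num)).const_mul ((4 * R * q ^ 4 * (2 * (10 * R ^ 2) ^ q / t) ^ (1 / 5 : ℝ)) ^ 2)
  refine hg.mono_fun ?_ ?_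
  · have := ((aestronglyMeasurable_asymptoticVelocity hR hJ q).sub
      (J.continuous_averagedVelocity q t).aestronglyMeasurable).norm.pow 2
    exact this.restrict
  · refine ae_restrict_of_ae (Real.ae_sin_ne_zero.mono fun θ hθ => ?_)
    beta_reduce
    rw [Real.norm_of_nonneg (by positivity), Real.norm_of_nonneg (by positivity)]
    exact sq_norm_asymptoticVelocity_sub_le hR hJ hθ ht

theorem sqrt_integral_sq_norm_sub_le (hR : 0 < R) (hJ : J ∈ boundedClass R) (q : ℕ) {t : ℝ}
    (ht : 0 < t) :
    Real.sqrt (∫ θ in (0 : ℝ)..(2 * Real.pi),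
        ‖J.asymptoticVelocity q θ - J.averagedVelocity q θ t‖ ^ 2 / (2 * Real.pi))
      ≤ 4 * R * q ^ 4 * (2 * (10 * R ^ 2) ^ q / t) ^ (1 / 5 : ℝ)
        * Real.sqrt ((∫ θ in (0 : ℝ)..(2 * Real.pi), |Real.sin θ| ^ (-(4 / 5) : ℝ))
          / (2 * Real.pi)) := by
  set M := 4 * R * q ^ 4 * (2 * (10 * R ^ 2) ^ q / t) ^ (1 / 5 : ℝ) with hM
  have hM0 : 0 ≤ M := by positivity
  have hπ := Real.pi_pos
  have hle : ∫ θ in (0 : ℝ)..(2 * Real.pi),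
      ‖J.asymptoticVelocity q θ - J.averagedVelocity q θ t‖ ^ 2
      ≤ M ^ 2 * ∫ θ in (0 : ℝ)..(2 * Real.pi), |Real.sin θ| ^ (-(4 / 5) : ℝ) := by
    rw [← intervalIntegral.integral_const_mul]
    exact intervalIntegral.integral_mono_ae (by positivity)
      (intervalIntegrable_sq_norm_sub hR hJ q ht)
      ((Real.intervalIntegrable_abs_sin_rpow (by norm_num) (by norm_num)).const_mul _)
      (Real.ae_sin_ne_zero.mono fun θ hθ => sq_norm_asymptoticVelocity_sub_le hR hJ hθ ht)
  rw [intervalIntegral.integral_div, ← Real.sqrt_sq hM0, ← Real.sqrt_mul (sq_nonneg M),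
    ← mul_div_assoc]
  exact Real.sqrt_le_sqrt (by gcongr)

end JacobiMatrix

end

theorem theoremt :
    ∀ R : ℝ, 0 < R → ∃ C₁ : ℝ, 1 < C₁ ∧
      ∀ (q : ℕ) (J : JacobiMatrix), J.IsPeriodic q → J ∈ JacobiMatrix.boundedClass R →
        (∀ θ ∈ Ioo (0 : ℝ) (2 * Real.pi), θ ≠ Real.pi →
          ∀ j : Fin q, DifferentiableAt ℝ (J.eigenvalue q j) θ) ∧
        ∀ t : ℝ, 0 < t →
          IntervalIntegrable
            (fun θ => ‖J.asymptoticVelocity q θ - J.averagedVelocity q θ t‖ ^ 2)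
            volume 0 (2 * Real.pi) ∧
          Real.sqrt (∫ θ in (0 : ℝ)..(2 * Real.pi),
              ‖J.asymptoticVelocity q θ - J.averagedVelocity q θ t‖ ^ 2 / (2 * Real.pi))
            ≤ C₁ ^ q * t ^ (-(1 / 5) : ℝ) := by
  intro R hR
  set S := Real.sqrt ((∫ θ in (0 : ℝ)..(2 * Real.pi), |Real.sin θ| ^ (-(4 / 5) : ℝ))
    / (2 * Real.pi)) with hS
  have hS0 : 0 ≤ S := Real.sqrt_nonneg _
  -- `16 ^ q` absorbs `q ^ 4`, the power of `10 * R ^ 2 + 1` absorbs the gap constant, and the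
  -- prefactor `8 * R * S` is absorbed since `q ≥ 1`. The summands `2` and `1` make the constant
  -- exceed `1` even for small `R`.
  refine ⟨(8 * R * S + 2) * (16 * (10 * R ^ 2 + 1)), ?_, fun q J hper hJ => ⟨?_, fun t ht =>
    ⟨JacobiMatrix.intervalIntegrable_sq_norm_sub hR hJ q ht, ?_⟩⟩⟩
  · have h1 : 2 ≤ 8 * R * S + 2 := by nlinarith [mul_nonneg hR.le hS0]
    nlinarith [sq_nonneg R]
  · intro θ hθ hπ j
    obtain ⟨d, -, h⟩ := JacobiMatrix.exists_hasDerivAt_floquet_eigenvalue (J := J)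
      (Real.sin_ne_zero_of_mem_Ioo hθ hπ) j
    exact h.differentiableAt
  · have hR1 := JacobiMatrix.one_le_of_mem_boundedClass hR hJ
    refine (JacobiMatrix.sqrt_integral_sq_norm_sub_le hR hJ q ht).trans ?_
    rw [← hS, Real.div_rpow (by positivity) ht.le, Real.rpow_neg ht.le, div_eq_mul_inv]
    have hK : 1 ≤ (10 * R ^ 2) ^ q := one_le_pow₀ (by nlinarith)
    have h1 : (2 * (10 * R ^ 2) ^ q) ^ (1 / 5 : ℝ) ≤ 2 * (10 * R ^ 2 + 1) ^ q :=
      (Real.rpow_le_self_of_one_le (by linarith) (by norm_num)).trans (by gcongr; linarith)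
    have h2 : (q : ℝ) ^ 4 ≤ 16 ^ q := by
      have : (q : ℝ) ≤ 2 ^ q := by exact_mod_cast Nat.lt_two_pow_self.le
      calc (q : ℝ) ^ 4 ≤ (2 ^ q) ^ 4 := by gcongr
        _ = 16 ^ q := by rw [← pow_mul, mul_comm, pow_mul]; norm_num
    have h3 : 8 * R * S + 2 ≤ (8 * R * S + 2) ^ q :=
      le_self_pow₀ (by nlinarith [mul_nonneg hR.le hS0]) hper.1.ne'
    have hRS := mul_nonneg hR.le hS0
    calc 4 * R * q ^ 4 * ((2 * (10 * R ^ 2) ^ q) ^ (1 / 5 : ℝ) * (t ^ (1 / 5 : ℝ))⁻¹) * S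
        ≤ 4 * R * 16 ^ q * ((2 * (10 * R ^ 2 + 1) ^ q) * (t ^ (1 / 5 : ℝ))⁻¹) * S := by gcongr
      _ = (8 * R * S) * (16 ^ q * (10 * R ^ 2 + 1) ^ q) * (t ^ (1 / 5 : ℝ))⁻¹ := by ring
      _ ≤ (8 * R * S + 2) ^ q * (16 ^ q * (10 * R ^ 2 + 1) ^ q) * (t ^ (1 / 5 : ℝ))⁻¹ := by
          gcongr; linarith
      _ = _ := by rw [mul_pow, mul_pow]
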